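/- **Conventions.** For sequences indexed by the integers $k\ge 1$, $a_k\lesssim b_k$ means that there is a constant $C>0$ with $a_k\le C\,b_k$ for all $k\ge1$. A *weight sequence* is a sequence $M=(M_k)_{k\ge0}$ with $M_k=\mu_0\mu_1\cdots\mu_k$, $1=\mu_0\le\mu_1\le\mu_2\le\cdots$ and $M_k^{1/k}\to\infty$; thus $\mu_k=M_k/M_{k-1}$ for $k\ge1$. A *weight matrix* is a set of weight sequences which is totally ordered by the pointwise order. A weight matrix $\mathfrak N$ is *admissible* if, writing $\nu_0=1$, $\nu_k=N_k/N_{k-1}$ and $\dot\nu_0=1$, $\dot\nu_k=\dot N_k/\dot N_{k-1}$, 1. for all $N,\dot N\in\mathfrak N$ we have $\nu\lesssim\dot\nu$ or $\dot\nu\lesssim\nu$; 2. $\sum_k 1/\nu_k<\infty$ for each $N\in\mathfrak N$; 3. for each $N\in\mathfrak N$ there is $C>0$ such that $\frac{\nu_{k+1}}{\nu_k}\le (C+1)+C\,\frac{\nu_{k+1}}{k+1}\sum_{j\ge k+1}\frac1{\nu_j}$ for all $k\in\mathbb N$; 4. for each $N\in\mathfrak N$ there is $\dot N\in\mathfrak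 N$ with $\nu_k\lesssim \dot N_k^{1/k}$; 5. for each $N\in\mathfrak N$ there is $\dot N\in\mathfrak N$ with $\nu_{2k}\lesssim\dot\nu_k$. A *weight function* is a continuous increasing function $\omega:[0,\infty)\to[0,\infty)$ with $\omega|_{[0,1]}=0$, $\lim_{t\to\infty}\omega(t)=\infty$, $\omega(2t)=O(\omega(t))$, $\omega(t)=O(t)$ and $\log t=o(\omega(t))$ as $t\to\infty$, such that $\varphi_\omega(t):=\omega(e^t)$ is convex. Put $\varphi_\omega^*(x):=\sup_{y\ge0}\,(xy-\varphi_\omega(y))$ for $x\ge0$. The weight matrix associated with $\omega$ is $\mathfrak W=\{W^x\}_{x>0}$ with $W^x_k:=\exp\big(\tfrac1x\varphi_\omega^*(xk)\big)$. A weight function is *admissible* if its associated weight matrix is admissible. For a weight function $\omega$, $\mathcal B^{\{\omega\}}(\mathbb R^n)$ is the set of all $f\in C^\infty(\mathbb R^n,\mathbb R)$ such that for some integer $\rho\ge1$ $$\sup_{x\in\mathbb R^n,\ \alpha\in\mathbb N^n}|\partial^\alpha f(x)|\exp\big(-\tfrac1\rho\varphi_\omega^*(\rho|\alpha|)\big)<\infty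 .$$ For a compact set $E\subseteq\mathbb R^n$, $\mathcal B^{\{\omega\}}(E)$ is the set of all families $F=(F^\alpha)_{\alpha\in\mathbb N^n}$ of continuous functions $F^\alpha:E\to\mathbb R$ for which there are $W\in\mathfrak W$ and $C,\rho>0$ such that $$|F^\alpha(a)|\le C\rho^{|\alpha|}W_{|\alpha|}\quad(\alpha\in\mathbb N^n,\ a\in E),$$ $$\Big|F^\alpha(b)-\sum_{|\beta|\le p-|\alpha|}\frac{(b-a)^\beta}{\beta!}F^{\alpha+\beta}(a)\Big|\le C\rho^{p+1}W_{p+1}\frac{|b-a|^{p+1-|\alpha|}}{(p+1-|\alpha|)!}\quad(p\in\mathbb N,\ |\alpha|\le p,\ a,b\in E).$$ The jet mapping is $j_E^\infty(f):=(\partial^\alpha f|_E)_{\alpha\in\mathbb N^n}$. **Corollary 5.8.** Let $\tau$ be an admissible weight function with associated weight matrix $\mathfrak T$, and let $\omega$ be a weight function with associated weight matrix $\mathfrak W$. Assume that for every $W\in\mathfrak W$ there is $T\in\mathfrak T$ such that $$\sum_{\ell\ge k}\frac{T_{\ell-1}}{T_\ell}\lesssim\frac{k\,W_{k-1}}{W_k}\qquad\text{and}\qquad\frac{W_k}{W_{k-1}}\lesssim\frac{T_k}{T_{k-1}}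 .$$ Let $E$ be a compact subset of $\mathbb R^n$. Then the jet mapping $j_E^\infty$ maps $\mathcal B^{\{\tau\}}(\mathbb R^n)$ onto a set containing $\mathcal B^{\{\omega\}}(E)$: for every $F\in\mathcal B^{\{\omega\}}(E)$ there is $f\in\mathcal B^{\{\tau\}}(\mathbb R^n)$ with $j_E^\infty(f)=F$. -/

import Mathlib

noncomputable section

namespace Ultradiff

/-! ### Weight sequences and weight matrices -/

/-- The quotients `μ 0 = 1`, `μ k = M k / M (k - 1)` (`k ≥ 1`) of a sequence `M`. -/
def quot (M : ℕ → ℝ) : ℕ → ℝ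
  | 0 => 1
  | k + 1 => M (k + 1) / M k

/-- `f ≲ g`: there is a constant `C > 0` with `f k ≤ C * g k` for all `k ≥ 1`. -/
def Lesssim (f g : ℕ → ℝ) : Prop :=
  ∃ C : ℝ, 0 < C ∧ ∀ k : ℕ, 1 ≤ k → f k ≤ C * g k

/-- Weight sequences: `M k = μ 0 * μ 1 * ⋯ * μ k` with `1 = μ 0 ≤ μ 1 ≤ μ 2 ≤ ⋯` and
`M k ^ (1 / k) → ∞`. -/
structure IsWeightSequence (M : ℕ → ℝ) : Prop where
  pos : ∀ k, 0 < M k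
  zero : M 0 = 1
  mono : Monotone (quot M)
  root_tendsto : Filter.Tendsto (fun k : ℕ => M k ^ (1 / (k : ℝ))) Filter.atTop Filter.atTop

/-- Weight matrices: sets of weight sequences that are totally ordered by the pointwise order. -/
structure IsWeightMatrix (𝔐 : Set (ℕ → ℝ)) : Prop where
  isWeightSequence : ∀ M ∈ 𝔐, IsWeightSequence M
  total : ∀ M ∈ 𝔐, ∀ M' ∈ 𝔐, M ≤ M' ∨ M' ≤ M

/-- Admissible weight matrices. -/
structure IsAdmissibleMatrix (𝔑 : Set (ℕ → ℝ)) : Prop where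
  isWeightMatrix : IsWeightMatrix 𝔑
  comparable : ∀ N ∈ 𝔑, ∀ N' ∈ 𝔑,
    Lesssim (quot N) (quot N') ∨ Lesssim (quot N') (quot N)
  summable : ∀ N ∈ 𝔑, Summable (fun k : ℕ => 1 / quot N k)
  quot_succ : ∀ N ∈ 𝔑, ∃ C : ℝ, 0 < C ∧ ∀ k : ℕ,
    quot N (k + 1) / quot N k
      ≤ (C + 1) + C * (quot N (k + 1) / ((k : ℝ) + 1)) * ∑' j : ℕ, 1 / quot N (k + 1 + j)
  quot_root : ∀ N ∈ 𝔑, ∃ N' ∈ 𝔑, Lesssim (quot N) (fun k => N' k ^ (1 / (k : ℝ)))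
  quot_two_mul : ∀ N ∈ 𝔑, ∃ N' ∈ 𝔑, Lesssim (fun k => quot N (2 * k)) (quot N')

/-! ### Weight functions -/

/-- Weight functions `ω : [0, ∞) → [0, ∞)`; only the values on `[0, ∞)` matter.
Nonnegativity there follows from monotonicity and the vanishing on `[0, 1]`. -/
structure IsWeightFunction (ω : ℝ → ℝ) : Prop where
  continuousOn : ContinuousOn ω (Set.Ici 0)
  monotoneOn : MonotoneOn ω (Set.Ici 0)
  eq_zero : ∀ t ∈ Set.Icc (0 : ℝ) 1, ω t = 0
  tendsto : Filter.Tendsto ω Filter.atTop Filter.atTop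
  two_mul : Asymptotics.IsBigO Filter.atTop (fun t : ℝ => ω (2 * t)) ω
  isBigO_id : Asymptotics.IsBigO Filter.atTop ω (fun t : ℝ => t)
  log_isLittleO : Asymptotics.IsLittleO Filter.atTop Real.log ω
  convex : ConvexOn ℝ Set.univ (fun t : ℝ => ω (Real.exp t))

/-- The Young conjugate `φ^*(x) = sup_{y ≥ 0} (x * y - φ y)` of `φ t = ω (exp t)`. -/
def youngConj (ω : ℝ → ℝ) (x : ℝ) : ℝ :=
  sSup ((fun y : ℝ => x * y - ω (Real.exp y)) '' Set.Ici 0)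

/-- The sequence `W^x k = exp (φ^*(x k) / x)`. -/
def assocSeq (ω : ℝ → ℝ) (x : ℝ) (k : ℕ) : ℝ :=
  Real.exp (1 / x * youngConj ω (x * k))

/-- The weight matrix `{W^x : x > 0}` associated with `ω`. -/
def assocMatrix (ω : ℝ → ℝ) : Set (ℕ → ℝ) :=
  {W | ∃ x : ℝ, 0 < x ∧ W = assocSeq ω x}

/-- Admissible weight functions: weight functions whose associated weight matrix is admissible. -/
structure IsAdmissible (ω : ℝ → ℝ) : Prop where
  isWeightFunction : IsWeightFunction ω
  isAdmissibleMatrix : IsAdmissibleMatrix (assocMatrix ω)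

/-! ### Ultradifferentiable functions -/

/-- The length `|α|` of a multi-index. -/
def deg {n : ℕ} (α : Fin n → ℕ) : ℕ := ∑ i, α i

/-- The partial derivative in the `i`-th coordinate. -/
def coordDeriv {n : ℕ} (i : Fin n) (f : EuclideanSpace ℝ (Fin n) → ℝ) :
    EuclideanSpace ℝ (Fin n) → ℝ :=
  fun x => fderiv ℝ f x (EuclideanSpace.single i 1)

/-- The partial derivative `∂^α f` (only used for smooth `f`, where the order of
differentiation plays no role). -/
def partialDeriv {n : ℕ} (α : Fin n → ℕ) (f : EuclideanSpace ℝ (Fin n) → ℝ) :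
    EuclideanSpace ℝ (Fin n) → ℝ :=
  (List.finRange n).foldr (fun i g => (coordDeriv i)^[α i] g) f

/-- The class `B^{ω}(ℝⁿ)`: smooth functions `f` such that, for some integer `ρ ≥ 1`,
`|∂^α f x| * exp (-φ^*(ρ |α|) / ρ)` is bounded in `x` and `α`. -/
def globalClass (ω : ℝ → ℝ) (n : ℕ) : Set (EuclideanSpace ℝ (Fin n) → ℝ) :=
  {f | ContDiff ℝ ((⊤ : ℕ∞) : WithTop ℕ∞) f ∧
    ∃ ρ : ℕ, 0 < ρ ∧ ∃ C : ℝ, ∀ (α : Fin n → ℕ) (x : EuclideanSpace ℝ (Fin n)),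
      |partialDeriv α f x| * Real.exp (-(1 / (ρ : ℝ) * youngConj ω (ρ * deg α))) ≤ C}

/-! ### Whitney jets -/

/-- Families `(F^α)_α` of real functions on `E`, indexed by multi-indices. Continuity of the
members is required in the class of Whitney jets below. -/
abbrev JetFamily {n : ℕ} (E : Set (EuclideanSpace ℝ (Fin n))) : Type :=
  (Fin n → ℕ) → E → ℝ

/-- The jet mapping `f ↦ (∂^α f|_E)_α`. -/
def jetMap {n : ℕ} (E : Set (EuclideanSpace ℝ (Fin n))) (f : EuclideanSpace ℝ (Fin n) → ℝ) :
    JetFamily E :=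
  fun α a => partialDeriv α f a

/-- The remainder
`(R_a^p F)^α (b) = F^α(b) - ∑_{|β| ≤ p - |α|} (b - a)^β / β! * F^{α + β}(a)`, for `|α| ≤ p`. -/
def jetRemainder {n : ℕ} {E : Set (EuclideanSpace ℝ (Fin n))} (F : JetFamily E)
    (p : ℕ) (α : Fin n → ℕ) (a b : E) : ℝ :=
  F α b - ∑ k ∈ Finset.range (p - deg α + 1), ∑ β ∈ Finset.piAntidiag Finset.univ k,
    (∏ i, (b.1 i - a.1 i) ^ β i) / (∏ i, ((β i).factorial : ℝ)) * F (α + β) a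

/-- The Whitney jets on `E` of class `B^{M}` for a sequence `M`. -/
def jetClassSeq (M : ℕ → ℝ) {n : ℕ} (E : Set (EuclideanSpace ℝ (Fin n))) : Set (JetFamily E) :=
  {F | (∀ α, Continuous (F α)) ∧
    ∃ ρ : ℕ, 0 < ρ ∧ ∃ C : ℝ,
      (∀ (α : Fin n → ℕ) (a : E), |F α a| ≤ C * (ρ : ℝ) ^ deg α * M (deg α)) ∧
      (∀ (p : ℕ) (α : Fin n → ℕ), deg α ≤ p → ∀ a b : E,
        |jetRemainder F p α a b| ≤ C * (ρ : ℝ) ^ (p + 1) * M (p + 1) *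
          (‖b.1 - a.1‖ ^ (p + 1 - deg α) / ((p + 1 - deg α).factorial : ℝ)))}

/-- The Whitney jets on `E` of class `B^{ω}`: those of class `B^{W}` for some `W` in the weight
matrix associated with `ω`. -/
def jetClass (ω : ℝ → ℝ) {n : ℕ} (E : Set (EuclideanSpace ℝ (Fin n))) : Set (JetFamily E) :=
  {F | ∃ W ∈ assocMatrix ω, F ∈ jetClassSeq W E}

end Ultradiff

end

/-! Write `ν` for the quotients of a sequence `T` in the matrix of `τ`, `r = descRatio ν`, `s k =
invProd r k` and `h(t) = min_k s_k t^k` (`minWeight`). Two facts link these to the data. Since `(j +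
1) / ν (j + 1) ≤ r j`, the sequence `k! s_k` lies below `T`. The two assumed relations together say
that `W` lies below `k! s_k` up to geometric factors (`IsNonquasi.exists_le_invProd`), so a jet of
class `W` satisfies Whitney estimates for `k! s_k`.

The extension balances a gain against a loss. If the degrees of the Taylor polynomials are adapted
to the scale `t`, those at points of `E` at distance of order `t` differ by a multiple of `h(t)`,
with derivatives growing like `k! t^{-k}` (`JetBound.norm_sub_le`). Cutting off at width of order
`t` within the class of a sequence `N` costs a factor `1 / h_N(K t)` per variable
(`IsNonquasi.exists_step`, `IsNonquasi.exists_partition`). The condition on `ν (2 k)` gives `h(t) ≤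
h_N(D t)^(2 n + 2)` for a suitable `N` of the matrix, so the gain outweighs all losses
(`IsAdmissibleMatrix.exists_minWeight_le`).

No Whitney cubes are needed (`JetBound.exists_extension`). For scales `t_m = r 0 / 2^m` take grid
partitions of unity `Θ_{m,k}` and Taylor polynomials `P_{m,k}` at nearby points of `E`, and put `f =
∑_m ∑_{k,l} Θ_{m,k} Θ_{m+1,l} (P_{m+1,l} - P_{m,k})`. The series converges with all derivatives on
the whole space. Near `E` it telescopes to `∑_k Θ_{m,k} P_{m,k}`, which approximates the jet ever
better. Finally, geometric factors are absorbed by changing the parameter of the matrix of `τ`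
(`IsWeightFunction.exists_pow_mul_assocSeq_le`). -/

open Filter Topology

namespace Ultradiff

/-! ### Weights given by a decreasing null sequence -/

/-- The sequence `s k = ∏_{j < k} 1 / r j`. -/
noncomputable def invProd (r : ℕ → ℝ) (k : ℕ) : ℝ := ∏ j ∈ Finset.range k, (r j)⁻¹

/-- The least `k` with `r k ≤ t`. -/
noncomputable def cutIndex (r : ℕ → ℝ) (t : ℝ) : ℕ := sInf {k | r k ≤ t}

/-- The minimum over `k` of `s k * t ^ k`, where `s = invProd r`. -/
noncomputable def minWeight (r : ℕ → ℝ) (t : ℝ) : ℝ := invProd r (cutIndex r t) * t ^ cutIndex r t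

/-- Positive decreasing null sequences. -/
structure IsNull (r : ℕ → ℝ) : Prop where
  pos : ∀ k, 0 < r k
  anti : Antitone r
  lim : Tendsto r atTop (𝓝 0)

section

variable {r : ℕ → ℝ} (hr : IsNull r)
include hr

lemma IsNull.invProd_pos (k : ℕ) : 0 < invProd r k :=
  Finset.prod_pos fun j _ => inv_pos.2 (hr.pos j)

omit hr in
lemma invProd_zero : invProd r 0 = 1 := by simp [invProd]

omit hr in
lemma invProd_succ (k : ℕ) : invProd r (k + 1) = invProd r k * (r k)⁻¹ :=
  Finset.prod_range_succ _ _

lemma IsNull.le_cutIndex {t : ℝ} (ht : 0 < t) : r (cutIndex r t) ≤ t := by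
  have : {k | r k ≤ t}.Nonempty :=
    ((hr.lim.eventually (gt_mem_nhds ht)).mono fun _ h => h.le).exists
  exact Nat.sInf_mem this

omit hr in
lemma lt_of_lt_cutIndex {t : ℝ} {k : ℕ} (h : k < cutIndex r t) : t < r k := by
  by_contra hk
  exact Nat.notMem_of_lt_sInf h (not_lt.1 hk)

lemma IsNull.lt_cutIndex {t : ℝ} (ht : 0 < t) {k : ℕ} (h : t < r k) : k < cutIndex r t := by
  by_contra hk
  exact absurd ((hr.anti (not_lt.1 hk)).trans (hr.le_cutIndex ht)) (not_le.2 h)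

lemma IsNull.cutIndex_anti {t u : ℝ} (ht : 0 < t) (h : t ≤ u) :
    cutIndex r u ≤ cutIndex r t :=
  Nat.sInf_le ((hr.le_cutIndex ht).trans h)

omit hr in
lemma cutIndex_eq_zero {t : ℝ} (h : r 0 ≤ t) : cutIndex r t = 0 :=
  Nat.le_zero.1 (Nat.sInf_le h)

lemma IsNull.minWeight_pos {t : ℝ} (ht : 0 < t) : 0 < minWeight r t :=
  mul_pos (hr.invProd_pos _) (pow_pos ht _)

/-- The ratio of consecutive terms of `k ↦ invProd r k * t ^ k` is `t / r k`: below one before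
`cutIndex r t`, at least one from there on. The terms thus fall to the minimum at `cutIndex r t` and
then rise. The monotone descent is needed in its own right for comparing Taylor polynomials of
different degrees. -/
lemma IsNull.invProd_mul_pow_le {t : ℝ} (ht : 0 < t) {j k : ℕ} (hjk : j ≤ k)
    (hk : k ≤ cutIndex r t) : invProd r k * t ^ k ≤ invProd r j * t ^ j := by
  induction k, hjk using Nat.le_induction with
  | base => exact le_rfl
  | succ k hjk ih =>
    refine le_trans ?_ (ih (by omega))
    have h1 : (r k)⁻¹ * t ≤ 1 := by
      rw [inv_mul_le_iff₀ (hr.pos k), mul_one]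
      exact (lt_of_lt_cutIndex (by omega)).le
    have h2 : 0 ≤ invProd r k * t ^ k :=
      (mul_pos (hr.invProd_pos _) (pow_pos ht _)).le
    calc invProd r (k + 1) * t ^ (k + 1) = invProd r k * t ^ k * ((r k)⁻¹ * t) := by
          rw [invProd_succ]; ring
      _ ≤ _ := mul_le_of_le_one_right h2 h1

lemma IsNull.minWeight_le {t : ℝ} (ht : 0 < t) (k : ℕ) : minWeight r t ≤ invProd r k * t ^ k := by
  rcases le_total k (cutIndex r t) with h | h
  · exact hr.invProd_mul_pow_le ht h le_rfl
  · induction k, h using Nat.le_induction with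
    | base => exact le_rfl
    | succ k hk ih =>
      refine ih.trans ?_
      have h1 : 1 ≤ (r k)⁻¹ * t := by
        rw [le_inv_mul_iff₀ (hr.pos k), mul_one]
        exact (hr.anti hk).trans (hr.le_cutIndex ht)
      have h2 : 0 ≤ invProd r k * t ^ k :=
        (mul_pos (hr.invProd_pos _) (pow_pos ht _)).le
      calc _ ≤ invProd r k * t ^ k * ((r k)⁻¹ * t) := le_mul_of_one_le_right h2 h1
        _ = _ := by rw [invProd_succ]; ring

lemma IsNull.minWeight_le_one {t : ℝ} (ht : 0 < t) : minWeight r t ≤ 1 := by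
  simpa [invProd_zero] using hr.minWeight_le ht 0

lemma IsNull.minWeight_le_mul {t : ℝ} (ht : 0 < t) : minWeight r t ≤ (r 0)⁻¹ * t := by
  simpa [invProd_zero, invProd_succ] using hr.minWeight_le ht 1

/-- `t⁻ᵏ h(t) ≤ s k`. -/
lemma IsNull.minWeight_mul_inv_pow_le {t : ℝ} (ht : 0 < t) (k : ℕ) :
    minWeight r t * t⁻¹ ^ k ≤ invProd r k := by
  rw [inv_pow, ← div_eq_mul_inv, div_le_iff₀ (pow_pos ht k)]
  exact hr.minWeight_le ht k

lemma IsNull.minWeight_mono {t u : ℝ} (ht : 0 < t) (h : t ≤ u) :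
    minWeight r t ≤ minWeight r u :=
  (hr.minWeight_le ht (cutIndex r u)).trans
    (mul_le_mul_of_nonneg_left (pow_le_pow_left₀ ht.le h _) (hr.invProd_pos _).le)

end

/-! ### The descendant of a weight sequence -/

/-- The sequence `r j = (j + 1) / ν (j + 1) + ∑_{i ≥ j + 1} 1 / ν i`. -/
noncomputable def descRatio (ν : ℕ → ℝ) (j : ℕ) : ℝ :=
  ((j : ℝ) + 1) / ν (j + 1) + ∑' i : ℕ, 1 / ν (j + 1 + i)

lemma summable_shift {f : ℕ → ℝ} (hf : Summable f) (k : ℕ) : Summable fun i => f (k + i) := by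
  simpa [add_comm] using (summable_nat_add_iff k).2 hf

/-- At least `k / 2` terms with index between `k / 2` and `k` are no smaller than `a k`, so `k * a
k` is at most twice the tail from `k / 2`. -/
lemma tendsto_mul_of_antitone_summable {a : ℕ → ℝ} (h0 : ∀ k, 0 ≤ a k) (ha : Antitone a)
    (hs : Summable a) : Tendsto (fun k : ℕ => (k : ℝ) * a k) atTop (𝓝 0) := by
  have h1 : Tendsto (fun k : ℕ => ∑' i, a (i + k / 2)) atTop (𝓝 0) :=
    (tendsto_sum_nat_add a).comp (Nat.tendsto_div_const_atTop two_ne_zero)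
  have h2 : Tendsto (fun k : ℕ => 2 * ∑' i, a (i + k / 2)) atTop (𝓝 0) := by
    simpa using h1.const_mul 2
  refine squeeze_zero (fun k => mul_nonneg k.cast_nonneg (h0 k)) (fun k => ?_) h2
  have h3 : ∑ i ∈ Finset.range (k - k / 2), a (i + k / 2) ≤ ∑' i, a (i + k / 2) :=
    ((summable_nat_add_iff (k / 2)).2 hs).sum_le_tsum _ fun i _ => h0 _
  have h4 : ∑ i ∈ Finset.range (k - k / 2), a k ≤
      ∑ i ∈ Finset.range (k - k / 2), a (i + k / 2) :=
    Finset.sum_le_sum fun i hi => ha (by have := Finset.mem_range.1 hi; omega)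
  rw [Finset.sum_const, Finset.card_range, nsmul_eq_mul] at h4
  have h5 : (k : ℝ) ≤ 2 * ((k - k / 2 : ℕ) : ℝ) := by
    exact_mod_cast (show k ≤ 2 * (k - k / 2) by omega)
  nlinarith [h0 k]

/-- The sequences used here: positive increasing with summable reciprocals. -/
structure IsNonquasi (ν : ℕ → ℝ) : Prop where
  pos : ∀ k, 0 < ν k
  mono : Monotone ν
  summable : Summable fun k => 1 / ν k

section

variable {ν : ℕ → ℝ} (hν : IsNonquasi ν)
include hν

lemma IsNonquasi.anti : Antitone fun k => 1 / ν k := fun _ _ h =>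
  one_div_le_one_div_of_le (hν.pos _) (hν.mono h)

lemma IsNonquasi.tsum_nonneg (k : ℕ) : 0 ≤ ∑' i : ℕ, 1 / ν (k + i) :=
  _root_.tsum_nonneg fun _ => (one_div_pos.2 (hν.pos _)).le

lemma IsNonquasi.tsum_eq (k : ℕ) :
    ∑' i : ℕ, 1 / ν (k + i) = 1 / ν k + ∑' i : ℕ, 1 / ν (k + 1 + i) := by
  rw [(summable_shift hν.summable k).tsum_eq_zero_add]
  simp [add_assoc, add_comm 1]

/-- Moving the first term of the tail to the front, `descRatio ν k` becomes `(k + 2) / ν (k + 1)`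
plus the tail from `k + 2`, while `descRatio ν (k + 1)` is `(k + 2) / ν (k + 2)` plus the same tail.
Monotonicity of `ν` therefore gives antitonicity. -/
lemma IsNonquasi.isNull : IsNull (descRatio ν) where
  pos k := add_pos_of_pos_of_nonneg (div_pos (by positivity) (hν.pos _)) (hν.tsum_nonneg _)
  anti := antitone_nat_of_succ_le fun k => by
    rw [descRatio, descRatio, hν.tsum_eq (k + 1)]
    have h := hν.anti (Nat.le_succ (k + 1))
    have e : ((k : ℝ) + 1 + 1) / ν (k + 1 + 1) - ((k : ℝ) + 1) / ν (k + 1)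
        = ((k : ℝ) + 2) * (1 / ν (k + 1 + 1) - 1 / ν (k + 1)) + 1 / ν (k + 1) := by ring
    have h3 : ((k : ℝ) + 2) * (1 / ν (k + 1 + 1) - 1 / ν (k + 1)) ≤ 0 :=
      mul_nonpos_of_nonneg_of_nonpos (by positivity) (sub_nonpos.2 h)
    push_cast
    linarith
  lim := by
    have h1 : Tendsto (fun k : ℕ => ((k : ℝ) + 1) / ν (k + 1)) atTop (𝓝 0) := by
      have := (tendsto_mul_of_antitone_summable (fun k => (one_div_pos.2 (hν.pos k)).le)
        hν.anti hν.summable).comp (tendsto_add_atTop_nat 1)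
      refine this.congr fun k => ?_
      simp [div_eq_mul_inv]
    have h2 : Tendsto (fun k : ℕ => ∑' i : ℕ, 1 / ν (k + 1 + i)) atTop (𝓝 0) := by
      have := (tendsto_sum_nat_add fun k => 1 / ν k).comp (tendsto_add_atTop_nat 1)
      refine this.congr fun k => tsum_congr fun i => ?_
      rw [add_comm]
    have h3 := h1.add h2
    rw [add_zero] at h3
    exact h3

lemma IsNonquasi.div_le_descRatio (j : ℕ) : ((j : ℝ) + 1) / ν (j + 1) ≤ descRatio ν j :=
  le_add_of_nonneg_right (hν.tsum_nonneg _)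

lemma IsNonquasi.tsum_le_descRatio (j : ℕ) : ∑' i : ℕ, 1 / ν (j + 1 + i) ≤ descRatio ν j :=
  le_add_of_nonneg_left (div_pos (by positivity) (hν.pos _)).le

/-- `k! s k ≤ ν 1 ⋯ ν k`. -/
lemma IsNonquasi.factorial_mul_invProd_le (k : ℕ) :
    (k.factorial : ℝ) * invProd (descRatio ν) k ≤ ∏ j ∈ Finset.range k, ν (j + 1) := by
  rw [← Finset.prod_range_add_one_eq_factorial, invProd, Nat.cast_prod, ← Finset.prod_mul_distrib]
  refine Finset.prod_le_prod (fun j _ => ?_) fun j _ => ?_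
  · exact mul_nonneg (Nat.cast_nonneg _) (inv_pos.2 (hν.isNull.pos j)).le
  · have h := hν.div_le_descRatio j
    rw [div_le_iff₀ (hν.pos _)] at h
    rw [← div_eq_mul_inv, div_le_iff₀ (hν.isNull.pos j)]
    push_cast
    linarith

/-- If `ν (2 k) ≲ ν' k` then the minimal weights satisfy `h t ≤ h' (C t) ^ 2`. -/
lemma IsNonquasi.minWeight_le_sq {ν' : ℕ → ℝ} (hν' : IsNonquasi ν') {C : ℝ} (hC : 0 < C)
    (h : ∀ k, 1 ≤ k → ν (2 * k) ≤ C * ν' k) {t : ℝ} (ht : 0 < t) :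
    minWeight (descRatio ν) t ≤ minWeight (descRatio ν') (C * t) ^ 2 := by
  have hinv : ∀ k, 1 ≤ k → 1 / ν' k ≤ C * (1 / ν (2 * k)) := fun k hk => by
    rw [mul_one_div, div_le_div_iff₀ (hν'.pos _) (hν.pos _), one_mul]
    exact h k hk
  have key : ∀ j, descRatio ν' j ≤ C * descRatio ν (2 * j + 1) := fun j => by
    have h1 := hinv (j + 1) (by omega)
    have h2 : ∑' i : ℕ, 1 / ν' (j + 1 + i) ≤ ∑' i : ℕ, C * (1 / ν (2 * j + 1 + 1 + i)) := by
      -- The tail of `1 / ν'` is dominated by the even-indexed part of the tail of `1 / ν`.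
      refine Summable.tsum_le_tsum_of_inj (fun i => 2 * i) (fun a b hab => by simpa using hab)
        (fun c _ => mul_nonneg hC.le (one_div_pos.2 (hν.pos _)).le) (fun i => ?_)
        (summable_shift hν'.summable _) ((summable_shift hν.summable _).mul_left _)
      refine (hinv (j + 1 + i) (by omega)).trans (le_of_eq ?_)
      congr 3
      ring
    rw [tsum_mul_left] at h2
    have h3 : ((j : ℝ) + 1) / ν' (j + 1) ≤
        C * (((2 * j + 1 : ℕ) : ℝ) + 1) * (1 / ν (2 * j + 1 + 1)) := by
      rw [show ((j : ℝ) + 1) / ν' (j + 1) = ((j : ℝ) + 1) * (1 / ν' (j + 1)) by ring,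
        show C * (((2 * j + 1 : ℕ) : ℝ) + 1) * (1 / ν (2 * j + 1 + 1)) =
          (((2 * j + 1 : ℕ) : ℝ) + 1) * (C * (1 / ν (2 * (j + 1)))) by ring_nf]
      refine mul_le_mul ?_ h1 (one_div_pos.2 (hν'.pos _)).le (by positivity)
      push_cast
      linarith [(Nat.cast_nonneg j : (0 : ℝ) ≤ j)]
    calc descRatio ν' j ≤ C * (((2 * j + 1 : ℕ) : ℝ) + 1) * (1 / ν (2 * j + 1 + 1)) +
          C * ∑' i : ℕ, 1 / ν (2 * j + 1 + 1 + i) := add_le_add h3 h2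
      _ = _ := by rw [descRatio]; ring
  -- Factors are paired: those of index `2 k` and `2 k + 1` are both at most `C / r' k`.
  have hs : ∀ k, invProd (descRatio ν) (2 * k) ≤ C ^ (2 * k) * invProd (descRatio ν') k ^ 2 := by
    intro k
    induction k with
    | zero => simp [invProd]
    | succ k ih =>
      have p0 := hν.isNull.pos (2 * k)
      have p1 := hν.isNull.pos (2 * k + 1)
      have p2 := hν'.isNull.pos k
      have e1 : (descRatio ν (2 * k + 1))⁻¹ ≤ C * (descRatio ν' k)⁻¹ := by
        rw [inv_le_iff_one_le_mul₀ p1, mul_assoc, mul_comm, mul_assoc, le_inv_mul_iff₀ p2, mul_one]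
        rw [mul_comm]; exact key k
      have e0 : (descRatio ν (2 * k))⁻¹ ≤ C * (descRatio ν' k)⁻¹ :=
        (inv_anti₀ p1 (hν.isNull.anti (Nat.le_succ _))).trans e1
      have e2 : (descRatio ν (2 * k))⁻¹ * (descRatio ν (2 * k + 1))⁻¹ ≤
          (C * (descRatio ν' k)⁻¹) * (C * (descRatio ν' k)⁻¹) :=
        mul_le_mul e0 e1 (by positivity) (by positivity)
      calc invProd (descRatio ν) (2 * (k + 1))
          = invProd (descRatio ν) (2 * k) *
            ((descRatio ν (2 * k))⁻¹ * (descRatio ν (2 * k + 1))⁻¹) := by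
            rw [show 2 * (k + 1) = 2 * k + 1 + 1 by ring, invProd_succ, invProd_succ, mul_assoc]
        _ ≤ (C ^ (2 * k) * invProd (descRatio ν') k ^ 2) *
            ((C * (descRatio ν' k)⁻¹) * (C * (descRatio ν' k)⁻¹)) :=
            mul_le_mul ih e2 (by positivity) (by positivity)
        _ = _ := by rw [invProd_succ]; ring
  -- The left side is tested at twice the index that is optimal on the right.
  set k := cutIndex (descRatio ν') (C * t) with hk
  calc minWeight (descRatio ν) t ≤ invProd (descRatio ν) (2 * k) * t ^ (2 * k) :=
        hν.isNull.minWeight_le ht _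
    _ ≤ C ^ (2 * k) * invProd (descRatio ν') k ^ 2 * t ^ (2 * k) :=
        mul_le_mul_of_nonneg_right (hs k) (by positivity)
    _ = _ := by rw [minWeight, ← hk]; ring

end

/-! ### Weight sequences and admissible matrices through their quotients. -/

lemma prod_quot {N : ℕ → ℝ} (h0 : N 0 = 1) (hpos : ∀ k, 0 < N k) (k : ℕ) :
    ∏ j ∈ Finset.range k, quot N (j + 1) = N k := by
  induction k with
  | zero => simp [h0]
  | succ k ih =>
    rw [Finset.prod_range_succ, ih, quot, mul_div_cancel₀ _ (hpos k).ne']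

lemma IsWeightSequence.quot_pos {N : ℕ → ℝ} (hN : IsWeightSequence N) (k : ℕ) : 0 < quot N k := by
  cases k with
  | zero => exact one_pos
  | succ k => exact div_pos (hN.pos _) (hN.pos _)

lemma IsWeightSequence.mul_le {N : ℕ → ℝ} (hN : IsWeightSequence N) (i j : ℕ) :
    N i * N j ≤ N (i + j) := by
  induction j with
  | zero => simp [hN.zero]
  | succ j ih =>
    have e : ∀ k, N (k + 1) = N k * quot N (k + 1) := fun k => by
      rw [quot, mul_div_cancel₀ _ (hN.pos k).ne']
    rw [← add_assoc, e j, e (i + j), ← mul_assoc]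
    exact mul_le_mul ih (hN.mono (by omega)) (hN.quot_pos _).le (hN.pos _).le

lemma IsAdmissibleMatrix.isNonquasi {𝔑 : Set (ℕ → ℝ)} (h : IsAdmissibleMatrix 𝔑) {N : ℕ → ℝ}
    (hN : N ∈ 𝔑) : IsNonquasi (quot N) where
  pos := (h.isWeightMatrix.isWeightSequence N hN).quot_pos
  mono := (h.isWeightMatrix.isWeightSequence N hN).mono
  summable := h.summable N hN

/-- Each use of `quot_two_mul` squares the minimal weight. The resulting power pays for the negative
powers of the weight that the cutoff functions introduce. -/
lemma IsAdmissibleMatrix.exists_minWeight_le {𝔑 : Set (ℕ → ℝ)} (h : IsAdmissibleMatrix 𝔑)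
    {N : ℕ → ℝ} (hN : N ∈ 𝔑) (m : ℕ) :
    ∃ N' ∈ 𝔑, ∃ C : ℝ, 0 < C ∧ ∀ t, 0 < t →
      minWeight (descRatio (quot N)) t ≤ minWeight (descRatio (quot N')) (C * t) ^ 2 ^ m := by
  induction m with
  | zero => exact ⟨N, hN, 1, one_pos, fun t _ => by simp⟩
  | succ m ih =>
    obtain ⟨N₁, hN₁, C₁, hC₁, h₁⟩ := ih
    obtain ⟨N₂, hN₂, C₂, hC₂, h₂⟩ := h.quot_two_mul N₁ hN₁
    refine ⟨N₂, hN₂, C₂ * C₁, mul_pos hC₂ hC₁, fun t ht => (h₁ t ht).trans ?_⟩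
    rw [pow_succ', pow_mul, mul_assoc]
    exact pow_le_pow_left₀ ((h.isNonquasi hN₁).isNull.minWeight_pos (mul_pos hC₁ ht)).le
      ((h.isNonquasi hN₁).minWeight_le_sq (h.isNonquasi hN₂) hC₂ h₂ (mul_pos hC₁ ht)) _

/-! ### Smooth step functions by iterated averaging -/

/-- The average of `f` over `[x - a, x + a]`. -/
noncomputable def avg (a : ℝ) (f : ℝ → ℝ) (x : ℝ) : ℝ := (2 * a)⁻¹ * ∫ t in -a..a, f (x + t)

lemma avg_const (a : ℝ) (ha : 0 < a) (c : ℝ) (f : ℝ → ℝ) (x : ℝ)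
    (h : ∀ t ∈ Set.Icc (-a) a, f (x + t) = c) : avg a f x = c := by
  rw [avg, intervalIntegral.integral_congr (g := fun _ => c)]
  · rw [intervalIntegral.integral_const, smul_eq_mul]
    field_simp
    ring
  · intro t ht
    rw [Set.uIcc_of_le (by linarith)] at ht
    exact h t ht

lemma abs_avg_le {a : ℝ} (ha : 0 < a) {f : ℝ → ℝ} {x B : ℝ}
    (h : ∀ t ∈ Set.Icc (-a) a, |f (x + t)| ≤ B) : |avg a f x| ≤ B := by
  have h1 : ‖∫ t in -a..a, f (x + t)‖ ≤ B * |a - -a| := by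
    refine intervalIntegral.norm_integral_le_of_norm_le_const fun t ht => ?_
    rw [Set.uIoc_of_le (by linarith)] at ht
    exact h t ⟨ht.1.le, ht.2⟩
  rw [avg, abs_mul, abs_of_pos (by positivity), inv_mul_le_iff₀ (by positivity)]
  rw [Real.norm_eq_abs, abs_of_pos (a := a - -a) (by linarith)] at h1
  linarith

lemma avg_sub_avg {a : ℝ} {f g : ℝ → ℝ} (hf : Continuous f) (hg : Continuous g) (x y : ℝ) :
    avg a f x - avg a g y = avg a (fun t => f (x + t) - g (y + t)) 0 := by
  simp only [avg, zero_add]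
  rw [intervalIntegral.integral_sub, mul_sub]
  · exact (hf.comp (continuous_const.add continuous_id)).intervalIntegrable _ _
  · exact (hg.comp (continuous_const.add continuous_id)).intervalIntegrable _ _

lemma avg_lipschitz {a : ℝ} (ha : 0 < a) {f : ℝ → ℝ} {l : ℝ} (hf : Continuous f)
    (h : ∀ x y, |f x - f y| ≤ l * |x - y|) (x y : ℝ) : |avg a f x - avg a f y| ≤ l * |x - y| := by
  rw [avg_sub_avg hf hf x y]
  refine abs_avg_le ha fun t _ => (h _ _).trans (le_of_eq ?_)
  congr 2
  ring

/-- Averaging gains one derivative: that of `avg a f` is a difference quotient of `f`, so only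
continuity of `f` is required and the price is a factor `1 / a`. -/
lemma hasDerivAt_avg (a : ℝ) {f : ℝ → ℝ} (hf : Continuous f) (x : ℝ) :
    HasDerivAt (avg a f) ((2 * a)⁻¹ * (f (x + a) - f (x - a))) x := by
  have e : avg a f = fun x => (2 * a)⁻¹ * ((∫ t in 0..(x + a), f t) - ∫ t in 0..(x - a), f t) := by
    funext x
    rw [avg, intervalIntegral.integral_comp_add_left (fun t => f t) x,
      intervalIntegral.integral_interval_sub_left (hf.intervalIntegrable _ _)
      (hf.intervalIntegrable _ _), sub_eq_add_neg]
  rw [e]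
  have hd : ∀ z, HasDerivAt (fun u => ∫ t in 0..u, f t) (f z) z := fun z =>
    intervalIntegral.integral_hasDerivAt_right (hf.intervalIntegrable _ _)
      hf.stronglyMeasurable.stronglyMeasurableAtFilter hf.continuousAt
  have h1 := (hd (x + a)).comp_add_const x a
  have h2 := (hd (x - a)).comp_sub_const x a
  exact (h1.sub h2).const_mul _

lemma continuous_of_lipschitz {f : ℝ → ℝ} {l : ℝ} (hl : 0 ≤ l)
    (h : ∀ x y, |f x - f y| ≤ l * |x - y|) : Continuous f :=
  (LipschitzWith.of_dist_le_mul (K := ⟨l, hl⟩) fun x y => h x y).continuous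

/-- `avg (a k) (avg (a (k + 1)) (⋯ (avg (a (k + m - 1)) f)))`. -/
noncomputable def iterAvg (a : ℕ → ℝ) (f : ℝ → ℝ) : ℕ → ℕ → ℝ → ℝ
  | _, 0 => f
  | k, m + 1 => avg (a k) (iterAvg a f (k + 1) m)

section

variable {a : ℕ → ℝ} {f : ℝ → ℝ} {l : ℝ}

lemma iterAvg_lipschitz (ha : ∀ k, 0 < a k) (hl : 0 ≤ l) (h : ∀ x y, |f x - f y| ≤ l * |x - y|)
    (m k : ℕ) (x y : ℝ) : |iterAvg a f k m x - iterAvg a f k m y| ≤ l * |x - y| := by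
  induction m generalizing k x y with
  | zero => exact h x y
  | succ m ih =>
    exact avg_lipschitz (ha k) (continuous_of_lipschitz hl (ih (k + 1))) (ih (k + 1)) x y

lemma abs_iterAvg_le (ha : ∀ k, 0 < a k) {B : ℝ} (h : ∀ x, |f x| ≤ B)
    (m k : ℕ) (x : ℝ) : |iterAvg a f k m x| ≤ B := by
  induction m generalizing k x with
  | zero => exact h x
  | succ m ih => exact abs_avg_le (ha k) fun t _ => ih _ _

/-- The iterated average at `x` sees `f` only up to distance the sum of the widths. -/
lemma iterAvg_eq_const (ha : ∀ k, 0 < a k) {c : ℝ} (m k : ℕ) (x : ℝ)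
    (h : ∀ y, |y - x| ≤ ∑ i ∈ Finset.range m, a (k + i) → f y = c) : iterAvg a f k m x = c := by
  induction m generalizing k x with
  | zero => exact h x (by simp)
  | succ m ih =>
    refine avg_const _ (ha k) c _ _ fun t ht => ih _ _ fun y hy => h y ?_
    have e : ∀ i, k + (i + 1) = k + 1 + i := fun i => by ring
    rw [Finset.sum_range_succ', add_zero, Finset.sum_congr rfl fun i _ => congrArg a (e i)]
    have h1 : |y - x| ≤ |y - (x + t)| + |t| := by
      have := abs_add_le (y - (x + t)) t
      rwa [show y - (x + t) + t = y - x by ring] at this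
    have h2 : |t| ≤ a k := abs_le.2 ht
    linarith

/-- The additional average is the innermost one. It moves a Lipschitz function by at most `l` times
its width, and the outer averages do not increase uniform distances. -/
lemma abs_iterAvg_succ_sub_le (ha : ∀ k, 0 < a k) (hl : 0 ≤ l)
    (h : ∀ x y, |f x - f y| ≤ l * |x - y|) (m k : ℕ) (x : ℝ) :
    |iterAvg a f k (m + 1) x - iterAvg a f k m x| ≤ l * a (k + m) := by
  induction m generalizing k x with
  | zero =>
    have hf := continuous_of_lipschitz hl h
    change |avg (a k) f x - f x| ≤ l * a k
    rw [← avg_const (a k) (ha k) (f x) (fun _ => f x) x (fun _ _ => rfl),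
      avg_sub_avg hf continuous_const _ _]
    refine abs_avg_le (ha k) fun t ht => (h _ _).trans ?_
    refine mul_le_mul_of_nonneg_left ?_ hl
    rw [zero_add, add_sub_cancel_left]
    exact abs_le.2 ht
  | succ m ih =>
    have hc : ∀ m, Continuous (iterAvg a f (k + 1) m) := fun m =>
      continuous_of_lipschitz hl (iterAvg_lipschitz ha hl h m (k + 1))
    change |avg (a k) (iterAvg a f (k + 1) (m + 1)) x - avg (a k) (iterAvg a f (k + 1) m) x| ≤ _
    rw [avg_sub_avg (hc _) (hc _) _ _]
    refine abs_avg_le (ha k) fun t _ => (ih (k + 1) _).trans (le_of_eq ?_)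
    congr 2
    ring

/-- The limit of the iterated averages. -/
lemma exists_limit_iterAvg (ha : ∀ k, 0 < a k) (hs : Summable a) (hl : 0 ≤ l)
    (h : ∀ x y, |f x - f y| ≤ l * |x - y|) :
    ∃ g : ℕ → ℝ → ℝ, (∀ k x, Tendsto (fun m => iterAvg a f k m x) atTop (𝓝 (g k x))) ∧
      (∀ k x, HasDerivAt (g k) ((2 * a k)⁻¹ * (g (k + 1) (x + a k) - g (k + 1) (x - a k))) x) := by
  have hsum : ∀ k, Summable fun m => l * a (k + m) := fun k => (summable_shift hs k).mul_left l
  have hc : ∀ k x, CauchySeq fun m => iterAvg a f k m x := fun k x => by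
    refine cauchySeq_of_dist_le_of_summable _ (fun m => ?_) (hsum k)
    rw [dist_comm, Real.dist_eq]
    exact abs_iterAvg_succ_sub_le ha hl h m k x
  choose g hg using fun k x => cauchySeq_tendsto_of_complete (hc k x)
  have hlip : ∀ k x y, |g k x - g k y| ≤ l * |x - y| := fun k x y =>
    le_of_tendsto ((hg k x).sub (hg k y)).abs
      (Eventually.of_forall fun m => iterAvg_lipschitz ha hl h m k x y)
  have hcont : ∀ k, Continuous (g k) := fun k => continuous_of_lipschitz hl (hlip k)
  -- The bound does not depend on `x`; this uniformity lets the limit pass through the average,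
  -- giving `g k = avg (a k) (g (k + 1))`.
  have hdist : ∀ k m x, |iterAvg a f k m x - g k x| ≤ ∑' i, l * a (k + (i + m)) := fun k m x => by
    have h1 := dist_le_tsum_of_dist_le_of_tendsto (f := fun m => iterAvg a f k m x) _
      (fun m => by
        rw [dist_comm, Real.dist_eq]
        exact abs_iterAvg_succ_sub_le ha hl h m k x) (hsum k) (hg k x) m
    simpa [Real.dist_eq, add_comm m] using h1
  have havg : ∀ k, g k = avg (a k) (g (k + 1)) := fun k => by
    funext x
    refine tendsto_nhds_unique ((tendsto_add_atTop_iff_nat 1).2 (hg k x)) ?_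
    rw [tendsto_iff_dist_tendsto_zero]
    refine squeeze_zero (fun _ => dist_nonneg) (fun m => ?_)
      (tendsto_sum_nat_add fun m => l * a (k + 1 + m))
    rw [Real.dist_eq]
    change |avg (a k) (iterAvg a f (k + 1) m) x - avg (a k) (g (k + 1)) x| ≤ _
    rw [avg_sub_avg (continuous_of_lipschitz hl (iterAvg_lipschitz ha hl h m (k + 1)))
      (hcont _) _ _]
    exact abs_avg_le (ha k) fun t _ => hdist _ _ _
  refine ⟨g, hg, fun k x => ?_⟩
  have := hasDerivAt_avg (a k) (hcont (k + 1)) x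
  rwa [← havg] at this

end

/-- Each derivative uses up one averaging: it passes from `g k` to two translates of `g (k + 1)` and
costs `2 * (2 * a k)⁻¹ = (a k)⁻¹`. -/
lemma contDiff_and_iteratedDeriv_le {a : ℕ → ℝ} (ha : ∀ k, 0 < a k) {g : ℕ → ℝ → ℝ}
    (hb : ∀ k x, |g k x| ≤ 1)
    (hd : ∀ k x,
      HasDerivAt (g k) ((2 * a k)⁻¹ * (g (k + 1) (x + a k) - g (k + 1) (x - a k))) x) (j : ℕ) :
    ∀ k, ContDiff ℝ j (g k) ∧
      ∀ x, |iteratedDeriv j (g k) x| ≤ ∏ i ∈ Finset.range j, (a (k + i))⁻¹ := by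
  induction j with
  | zero =>
    refine fun k => ⟨contDiff_zero.2 (continuous_iff_continuousAt.2 fun x =>
      (hd k x).continuousAt), fun x => by simpa using hb k x⟩
  | succ j ih =>
    intro k
    have e : deriv (g k) = fun x => (2 * a k)⁻¹ * (g (k + 1) (x + a k) - g (k + 1) (x - a k)) :=
      funext fun x => (hd k x).deriv
    have c1 : ContDiff ℝ j fun x => g (k + 1) (x + a k) :=
      (ih (k + 1)).1.comp (contDiff_id.add contDiff_const)
    have c2 : ContDiff ℝ j fun x => g (k + 1) (x - a k) :=
      (ih (k + 1)).1.comp (contDiff_id.sub contDiff_const)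
    refine ⟨?_, fun x => ?_⟩
    · push_cast
      refine contDiff_succ_iff_deriv.2 ⟨fun x => (hd k x).differentiableAt, by simp, ?_⟩
      rw [e]
      exact contDiff_const.mul (c1.sub c2)
    · rw [iteratedDeriv_succ', e, iteratedDeriv_const_mul _ (c1.sub c2).contDiffAt]
      have e2 : iteratedDeriv j (fun x => g (k + 1) (x + a k) - g (k + 1) (x - a k)) x =
          iteratedDeriv j (g (k + 1)) (x + a k) - iteratedDeriv j (g (k + 1)) (x - a k) := by
        have := iteratedDeriv_sub c1.contDiffAt c2.contDiffAt (x := x)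
        rw [iteratedDeriv_comp_add_const, iteratedDeriv_comp_sub_const] at this
        exact this
      have e3 : ∀ i, k + (i + 1) = k + 1 + i := fun i => by ring
      rw [e2, abs_mul, abs_of_pos (inv_pos.2 (mul_pos two_pos (ha k))), Finset.prod_range_succ',
        add_zero, Finset.prod_congr rfl fun i _ => congrArg (fun i => (a i)⁻¹) (e3 i)]
      have h1 := (ih (k + 1)).2 (x + a k)
      have h2 := (ih (k + 1)).2 (x - a k)
      have h3 := (abs_sub _ _).trans (add_le_add h1 h2)
      have h4 := mul_le_mul_of_nonneg_left h3 (inv_pos.2 (mul_pos two_pos (ha k))).le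
      refine h4.trans (le_of_eq ?_)
      rw [mul_inv]
      ring

/-- Smooth steps with derivatives controlled by a given summable sequence. -/
lemma exists_step {a : ℕ → ℝ} (ha : ∀ k, 0 < a k) {δ : ℝ} (hδ : 0 < δ)
    (hs : ∀ m, ∑ i ∈ Finset.range m, a i ≤ δ) :
    ∃ g : ℝ → ℝ, ContDiff ℝ (⊤ : ℕ∞) g ∧ (∀ x ≤ -δ, g x = 0) ∧ (∀ x, 2 * δ ≤ x → g x = 1) ∧
      ∀ j x, |iteratedDeriv j g x| ≤ ∏ i ∈ Finset.range j, (a i)⁻¹ := by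
  have hsum : Summable a := summable_of_sum_range_le (fun k => (ha k).le) hs
  -- A ramp from 0 at `0` to 1 at `δ`; averaging with total width at most `δ` moves these thresholds
  -- to `-δ` and `2 * δ`.
  set f : ℝ → ℝ := fun x => max 0 (min 1 (δ⁻¹ * x)) with hf
  have hl : ∀ x y, |f x - f y| ≤ δ⁻¹ * |x - y| := fun x y => by
    have h1 := abs_max_sub_max_le_abs (min 1 (δ⁻¹ * x)) (min 1 (δ⁻¹ * y)) 0
    have h2 := abs_min_sub_min_le_max 1 (δ⁻¹ * x) 1 (δ⁻¹ * y)
    simp only [sub_self, abs_zero] at h2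
    rw [max_eq_right (abs_nonneg _), ← mul_sub, abs_mul, abs_of_pos (inv_pos.2 hδ)] at h2
    simp only [hf]
    rw [max_comm 0, max_comm 0]
    exact h1.trans h2
  obtain ⟨g, hg, hd⟩ := exists_limit_iterAvg ha hsum (inv_pos.2 hδ).le hl
  have hb : ∀ k x, |g k x| ≤ 1 := fun k x => by
    refine le_of_tendsto (hg k x).abs (Eventually.of_forall fun m => abs_iterAvg_le ha ?_ m k x)
    intro x
    rw [abs_of_nonneg (le_max_left _ _)]
    exact max_le zero_le_one (min_le_left _ _)
  have H := fun j => contDiff_and_iteratedDeriv_le ha hb hd j 0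
  refine ⟨g 0, contDiff_infty.2 fun j => (H j).1, fun x hx => ?_, fun x hx => ?_, fun j x => ?_⟩
  · refine tendsto_nhds_unique (hg 0 x) (tendsto_const_nhds.congr fun m => ?_)
    refine (iterAvg_eq_const ha m 0 x fun y hy => ?_).symm
    simp only [zero_add] at hy
    have hy0 : y ≤ 0 := by linarith [(abs_le.1 (hy.trans (hs m))).2]
    refine max_eq_left (min_le_of_right_le ?_)
    exact mul_nonpos_of_nonneg_of_nonpos (inv_pos.2 hδ).le hy0
  · refine tendsto_nhds_unique (hg 0 x) (tendsto_const_nhds.congr fun m => ?_)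
    refine (iterAvg_eq_const ha m 0 x fun y hy => ?_).symm
    simp only [zero_add] at hy
    have hy0 : δ ≤ y := by linarith [(abs_le.1 (hy.trans (hs m))).1]
    have : 1 ≤ δ⁻¹ * y := by rwa [le_inv_mul_iff₀ hδ, mul_one]
    simp only [hf]
    rw [min_eq_left this, max_eq_right zero_le_one]
  · simpa using (H j).2 x

/-- Smooth steps of width `δ` whose derivatives grow like `K ^ k ν 1 ⋯ ν k`, with the optimal
constant `1 / h (K δ)`. -/
lemma IsNonquasi.exists_step {ν : ℕ → ℝ} (hν : IsNonquasi ν) {K δ : ℝ} (hK : 0 < K) (hδ : 0 < δ) :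
    ∃ g : ℝ → ℝ, ContDiff ℝ (⊤ : ℕ∞) g ∧ (∀ x ≤ -δ, g x = 0) ∧ (∀ x, 2 * δ ≤ x → g x = 1) ∧
      ∀ k x, |iteratedDeriv k g x| ≤ Real.exp 1 * (2 * Real.exp 1 * K) ^ k *
        (∏ j ∈ Finset.range k, ν (j + 1)) / minWeight (descRatio ν) (K * δ) := by
  set κ := 2 * Real.exp 1 * K with hκ
  have hκ0 : 0 < κ := by positivity
  set t := κ * δ / 2 with htd
  have ht : 0 < t := by positivity
  set r := descRatio ν with hr
  have hnull : IsNull r := hν.isNull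
  set q := cutIndex r t with hq
  have hrq : r q ≤ t := hnull.le_cutIndex ht
  -- The first `q + 1` widths share `δ / 2` equally. The others match the desired growth, and their
  -- sum is at most `r q / κ ≤ t / κ = δ / 2` by the choice of `q`.
  set a : ℕ → ℝ := fun i => if i ≤ q then δ / (2 * ((q : ℝ) + 1)) else 1 / (κ * ν (i + 1)) with ha'
  have ha : ∀ k, 0 < a k := fun k => by
    simp only [ha']
    split_ifs
    · positivity
    · exact one_div_pos.2 (mul_pos hκ0 (hν.pos _))
  have hfirst : ∀ m, m ≤ q + 1 → ∑ i ∈ Finset.range m, a i ≤ δ / 2 := fun m hm => by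
    have : ∑ i ∈ Finset.range m, a i = m * (δ / (2 * ((q : ℝ) + 1))) := by
      rw [Finset.sum_congr rfl fun i hi => if_pos (by have := Finset.mem_range.1 hi; omega)]
      simp
    rw [this]
    have h1 : (m : ℝ) ≤ (q : ℝ) + 1 := by exact_mod_cast hm
    calc (m : ℝ) * (δ / (2 * ((q : ℝ) + 1))) ≤ ((q : ℝ) + 1) * (δ / (2 * ((q : ℝ) + 1))) :=
          mul_le_mul_of_nonneg_right h1 (by positivity)
      _ = δ / 2 := by field_simp
  have hs : ∀ m, ∑ i ∈ Finset.range m, a i ≤ δ := fun m => by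
    rcases le_total m (q + 1) with h | h
    · linarith [hfirst m h]
    · obtain ⟨d, rfl⟩ := Nat.exists_eq_add_of_le h
      rw [Finset.sum_range_add]
      have h2 : ∑ i ∈ Finset.range d, a (q + 1 + i) ≤ δ / 2 := by
        have e : ∀ i, a (q + 1 + i) = κ⁻¹ * (1 / ν (q + 1 + (i + 1))) := fun i => by
          simp only [ha']
          rw [if_neg (by omega), show q + 1 + i + 1 = q + 1 + (i + 1) by ring, one_div, one_div,
            mul_inv]
        simp only [e]
        rw [← Finset.mul_sum, inv_mul_le_iff₀ hκ0]
        have h3 : ∑ i ∈ Finset.range d, 1 / ν (q + 1 + (i + 1)) ≤ ∑' i, 1 / ν (q + 1 + i) := by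
          have := (summable_shift hν.summable (q + 1)).sum_le_tsum (Finset.range (d + 1))
            fun i _ => (one_div_pos.2 (hν.pos _)).le
          rw [Finset.sum_range_succ'] at this
          have h0 := (one_div_pos.2 (hν.pos (q + 1 + 0))).le
          linarith
        calc _ ≤ _ := h3
          _ ≤ r q := hν.tsum_le_descRatio q
          _ ≤ t := hrq
          _ = _ := by rw [htd]; ring
      linarith [hfirst (q + 1) le_rfl]
  obtain ⟨g, hg, g0, g1, hgd⟩ := Ultradiff.exists_step ha hδ hs
  refine ⟨g, hg, g0, g1, fun k x => (hgd k x).trans ?_⟩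
  have hu : 0 < K * δ := mul_pos hK hδ
  have hmpos := hnull.minWeight_pos hu
  -- the constant in front
  have hexp : Real.exp 1 ^ q * minWeight r (K * δ) ≤ minWeight r t := by
    have h1 := hnull.minWeight_le hu q
    have e : t = Real.exp 1 * (K * δ) := by rw [htd, hκ]; ring
    calc _ ≤ Real.exp 1 ^ q * (invProd r q * (K * δ) ^ q) :=
          mul_le_mul_of_nonneg_left h1 (by positivity)
      _ = minWeight r t := by rw [minWeight, ← hq, e]; ring
  -- The equal widths produce powers of `q + 1`, turned into factorials at the price of `e ^ q`.
  -- That price is met by `hexp`, since `κ` was chosen to make `t = e * (K * δ)`.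
  have hfac : ∀ p : ℕ, ((q : ℝ) + 1) ^ p ≤ Real.exp 1 * Real.exp 1 ^ q * p.factorial := fun p => by
    have := Real.pow_div_factorial_le_exp (x := (q : ℝ) + 1) (by positivity) p
    rw [div_le_iff₀ (by positivity)] at this
    rwa [← pow_succ', ← Real.exp_nat_mul, mul_one, Nat.cast_add, Nat.cast_one]
  have hsmall : ∀ p, (2 * ((q : ℝ) + 1) / δ) ^ p ≤ Real.exp 1 * κ ^ p *
      (p.factorial * invProd r p) / minWeight r (K * δ) := fun p => by
    rw [le_div_iff₀ hmpos]
    have h1 := hnull.minWeight_mul_inv_pow_le ht p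
    have e : 2 * ((q : ℝ) + 1) / δ = κ * (((q : ℝ) + 1) * t⁻¹) := by
      rw [htd]; field_simp
    calc (2 * ((q : ℝ) + 1) / δ) ^ p * minWeight r (K * δ)
        = κ ^ p * ((q : ℝ) + 1) ^ p * t⁻¹ ^ p * minWeight r (K * δ) := by
          rw [e, mul_pow κ, mul_pow ((q : ℝ) + 1)]; ring
      _ ≤ κ ^ p * (Real.exp 1 * Real.exp 1 ^ q * p.factorial) * t⁻¹ ^ p * minWeight r (K * δ) := by
          gcongr
          exact hfac p
      _ = κ ^ p * Real.exp 1 * p.factorial * t⁻¹ ^ p * (Real.exp 1 ^ q * minWeight r (K * δ)) := by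
          ring
      _ ≤ κ ^ p * Real.exp 1 * p.factorial * t⁻¹ ^ p * minWeight r t := by gcongr
      _ = κ ^ p * Real.exp 1 * p.factorial * (minWeight r t * t⁻¹ ^ p) := by ring
      _ ≤ κ ^ p * Real.exp 1 * p.factorial * invProd r p := by gcongr
      _ = _ := by ring
  have hle : ∀ p, p ≤ q + 1 → ∏ i ∈ Finset.range p, (a i)⁻¹ ≤ Real.exp 1 * κ ^ p *
      (∏ j ∈ Finset.range p, ν (j + 1)) / minWeight r (K * δ) := fun p hp => by
    have : ∏ i ∈ Finset.range p, (a i)⁻¹ = (2 * ((q : ℝ) + 1) / δ) ^ p := by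
      rw [Finset.prod_congr rfl fun i hi => congrArg _ (if_pos (by
        have := Finset.mem_range.1 hi; omega))]
      simp [div_pow]
    rw [this]
    refine (hsmall p).trans ?_
    gcongr
    exact hν.factorial_mul_invProd_le p
  rcases le_total k (q + 1) with h | h
  · exact hle k h
  · obtain ⟨d, rfl⟩ := Nat.exists_eq_add_of_le h
    rw [Finset.prod_range_add _ (q + 1), Finset.prod_range_add _ (q + 1)]
    have e : ∏ i ∈ Finset.range d, (a (q + 1 + i))⁻¹ =
        κ ^ d * ∏ i ∈ Finset.range d, ν (q + 1 + i + 1) := by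
      rw [← Finset.card_range d, ← Finset.prod_const, Finset.card_range,
        ← Finset.prod_mul_distrib]
      refine Finset.prod_congr rfl fun i _ => ?_
      simp only [ha']
      rw [if_neg (by omega), one_div, inv_inv]
    rw [e]
    have hp : 0 ≤ ∏ i ∈ Finset.range d, ν (q + 1 + i + 1) :=
      Finset.prod_nonneg fun i _ => (hν.pos _).le
    calc _ ≤ (Real.exp 1 * κ ^ (q + 1) * (∏ j ∈ Finset.range (q + 1), ν (j + 1)) /
          minWeight r (K * δ)) * (κ ^ d * ∏ i ∈ Finset.range d, ν (q + 1 + i + 1)) :=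
          mul_le_mul_of_nonneg_right (hle _ le_rfl) (mul_nonneg (by positivity) hp)
      _ = _ := by rw [pow_add κ (q + 1) d]; ring

/-! ### Bounds for all derivatives at a point -/

section

variable {V : Type*} [NormedAddCommGroup V] [NormedSpace ℝ V]

/-- At `x`, the derivatives of `f` of order `k` are bounded by `A * R ^ k * N k`. -/
def DerivBound (N : ℕ → ℝ) (x : V) (A R : ℝ) (f : V → ℝ) : Prop :=
  ∀ k : ℕ, ‖iteratedFDeriv ℝ k f x‖ ≤ A * R ^ k * N k

variable {N : ℕ → ℝ} (hpos : ∀ k, 0 < N k) (hmul : ∀ i j, N i * N j ≤ N (i + j)) {x : V}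

include hpos in
lemma DerivBound.mono {A A' R R' : ℝ} {f : V → ℝ} (h : DerivBound N x A R f) (hA : A ≤ A')
    (hA' : 0 ≤ A') (hR0 : 0 ≤ R) (hR : R ≤ R') : DerivBound N x A' R' f := fun k =>
  (h k).trans (mul_le_mul_of_nonneg_right
    (mul_le_mul hA (pow_le_pow_left₀ hR0 hR k) (pow_nonneg hR0 k) hA') (hpos k).le)

-- In the Leibniz rule, `N i * N j ≤ N (i + j)` takes the weights out of the sum, and the binomial
-- theorem adds the two rates.
include hpos hmul in
lemma DerivBound.mul {A B R S : ℝ} {f g : V → ℝ} (hf : ContDiff ℝ (⊤ : ℕ∞) f)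
    (hg : ContDiff ℝ (⊤ : ℕ∞) g) (hA : 0 ≤ A) (hB : 0 ≤ B) (hR : 0 ≤ R) (hS : 0 ≤ S)
    (h1 : DerivBound N x A R f) (h2 : DerivBound N x B S g) :
    DerivBound N x (A * B) (R + S) (fun y => f y * g y) := fun k => by
  refine (norm_iteratedFDeriv_mul_le hf hg x (n := k) (by exact_mod_cast le_top)).trans ?_
  rw [add_pow, Finset.mul_sum, Finset.sum_mul]
  refine Finset.sum_le_sum fun i hi => ?_
  have hik : i + (k - i) = k := by have := Finset.mem_range.1 hi; omega
  have h3 := hmul i (k - i)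
  rw [hik] at h3
  calc _ ≤ (k.choose i : ℝ) * (A * R ^ i * N i) * (B * S ^ (k - i) * N (k - i)) := by
        have e1 := h1 i
        have e2 := h2 (k - i)
        have := hpos i
        gcongr
    _ = (A * B * (R ^ i * S ^ (k - i) * (k.choose i : ℝ))) * (N i * N (k - i)) := by ring
    _ ≤ _ := mul_le_mul_of_nonneg_left h3 (by positivity)

include hpos hmul in
lemma DerivBound.prod {ι : Type*} (s : Finset ι) {A R : ℝ} {f : ι → V → ℝ} (hN : N 0 = 1)
    (hf : ∀ i, ContDiff ℝ (⊤ : ℕ∞) (f i)) (hA : 0 ≤ A) (hR : 0 ≤ R)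
    (h : ∀ i, DerivBound N x A R (f i)) :
    DerivBound N x (A ^ s.card) (s.card * R) (fun y => ∏ i ∈ s, f i y) := by
  classical
  induction s using Finset.induction_on with
  | empty =>
    intro k
    cases k with
    | zero => simp [hN]
    | succ k =>
      simp only [Finset.prod_empty]
      rw [iteratedFDeriv_const_of_ne (Nat.succ_ne_zero k)]
      simp
  | insert a s ha ih =>
    rw [Finset.card_insert_of_notMem ha, pow_succ']
    simp only [Finset.prod_insert ha]
    have := DerivBound.mul hpos hmul (hf a) (contDiff_prod fun i _ => hf i) hA (pow_nonneg hA _) hR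
      (by positivity) (h a) ih
    convert this using 1
    push_cast
    ring

-- Only the number of summands active near `x`, the cardinality of `u`, enters the bound; the size
-- of `s` plays no role.
include hpos in
lemma DerivBound.sum {ι : Type*} (s u : Finset ι) {A R : ℝ} {f : ι → V → ℝ} (hA : 0 ≤ A)
    (hR : 0 ≤ R) (hf : ∀ i, ContDiff ℝ (⊤ : ℕ∞) (f i)) (h : ∀ i ∈ u, DerivBound N x A R (f i))
    (h0 : ∀ i ∈ s, i ∉ u → f i =ᶠ[𝓝 x] 0) :
    DerivBound N x (u.card * A) R (fun y => ∑ i ∈ s, f i y) := fun k => by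
  classical
  rw [iteratedFDeriv_fun_sum_apply fun i _ => ((hf i).of_le (by exact_mod_cast le_top)).contDiffAt]
  have hz : ∀ i ∈ s, i ∉ s ∩ u → iteratedFDeriv ℝ k (f i) x = 0 := fun i hi hiu => by
    rw [((h0 i hi fun hu => hiu (Finset.mem_inter.2 ⟨hi, hu⟩)).iteratedFDeriv ℝ k).eq_of_nhds]
    simp
  rw [← Finset.sum_subset Finset.inter_subset_left hz]
  have h1 : 0 ≤ A * R ^ k * N k := mul_nonneg (by positivity) (hpos k).le
  calc _ ≤ ∑ i ∈ s ∩ u, A * R ^ k * N k :=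
        norm_sum_le_of_le _ fun i hi => h i (Finset.mem_inter.1 hi).2 k
    _ = ((s ∩ u).card : ℝ) * (A * R ^ k * N k) := by simp
    _ ≤ (u.card : ℝ) * (A * R ^ k * N k) := by
        gcongr
        exact Finset.inter_subset_right
    _ = _ := by ring

end

/-! ### Partial derivatives and iterated Fréchet derivatives -/

variable {n : ℕ}

local notation "𝔼" n => EuclideanSpace ℝ (Fin n)

lemma coordDeriv_contDiff (i : Fin n) {f : (𝔼 n) → ℝ} (hf : ContDiff ℝ (⊤ : ℕ∞) f) :
    ContDiff ℝ (⊤ : ℕ∞) (coordDeriv i f) :=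
  (hf.fderiv_right (m := (⊤ : ℕ∞)) (by simp)).clm_apply contDiff_const

lemma exists_coordDeriv_iterate_eq (i : Fin n) (m : ℕ) {k : ℕ} (v : Fin k → 𝔼 n)
    (hv : ∀ j, ‖v j‖ ≤ 1) : ∃ w : Fin (m + k) → 𝔼 n, (∀ j, ‖w j‖ ≤ 1) ∧
      ∀ f : (𝔼 n) → ℝ, ContDiff ℝ (⊤ : ℕ∞) f →
        (coordDeriv i)^[m] (fun x => iteratedFDeriv ℝ k f x v) =
          fun x => iteratedFDeriv ℝ (m + k) f x w := by
  induction m with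
  | zero =>
    rw [zero_add]
    exact ⟨v, hv, fun f _ => rfl⟩
  | succ m ih =>
    obtain ⟨w, hw, h⟩ := ih
    rw [show m + 1 + k = m + k + 1 by ring]
    refine ⟨Fin.cons (EuclideanSpace.single i 1) w, fun j => ?_, fun f hf => ?_⟩
    · refine Fin.cases ?_ (fun j => ?_) j
      · simp
      · simpa using hw j
    · rw [Function.iterate_succ_apply', h f hf]
      funext x
      rw [iteratedFDeriv_succ_apply_left, Fin.cons_zero, Fin.tail_cons, coordDeriv]
      have hd : DifferentiableAt ℝ (iteratedFDeriv ℝ (m + k) f) x :=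
        (hf.differentiable_iteratedFDeriv (m := m + k)
          (by exact_mod_cast WithTop.coe_lt_top _)).differentiableAt
      have := (hd.hasFDerivAt.continuousMultilinear_apply_const w).fderiv
      rw [this]
      rfl

/-- The vectors `w` do not depend on `f`. Hence `∂^α` at a point is one fixed continuous linear
functional of the iterated Fréchet derivative, which yields norm bounds, linearity and passage to
limits. -/
lemma exists_partialDeriv_eq (α : Fin n → ℕ) : ∃ w : Fin (deg α) → 𝔼 n, (∀ j, ‖w j‖ ≤ 1) ∧
    ∀ f : (𝔼 n) → ℝ, ContDiff ℝ (⊤ : ℕ∞) f →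
      partialDeriv α f = fun x => iteratedFDeriv ℝ (deg α) f x w := by
  have key : ∀ l : List (Fin n), ∃ w : Fin (l.map α).sum → 𝔼 n, (∀ j, ‖w j‖ ≤ 1) ∧
      ∀ f : (𝔼 n) → ℝ, ContDiff ℝ (⊤ : ℕ∞) f →
        l.foldr (fun i g => (coordDeriv i)^[α i] g) f =
          fun x => iteratedFDeriv ℝ (l.map α).sum f x w := by
    intro l
    induction l with
    | nil => exact ⟨fun _ => 0, by simp, fun f _ => rfl⟩
    | cons i l ih =>
      obtain ⟨v, hv, h⟩ := ih
      obtain ⟨w, hw, h'⟩ := exists_coordDeriv_iterate_eq i (α i) v hv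
      rw [List.map_cons, List.sum_cons]
      refine ⟨w, hw, fun f hf => ?_⟩
      rw [List.foldr_cons, h f hf]
      exact h' f hf
  have e : deg α = ((List.finRange n).map α).sum := by
    rw [deg, ← List.ofFn_eq_map, List.sum_ofFn]
  rw [e]
  exact key _

lemma abs_partialDeriv_le (α : Fin n → ℕ) {f : (𝔼 n) → ℝ} (hf : ContDiff ℝ (⊤ : ℕ∞) f)
    (x : 𝔼 n) : |partialDeriv α f x| ≤ ‖iteratedFDeriv ℝ (deg α) f x‖ := by
  obtain ⟨w, hw, h⟩ := exists_partialDeriv_eq α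
  rw [h f hf, ← Real.norm_eq_abs]
  refine ((iteratedFDeriv ℝ (deg α) f x).le_opNorm w).trans (mul_le_of_le_one_right
    (norm_nonneg _) (Finset.prod_le_one (fun _ _ => norm_nonneg _) fun j _ => hw j))

lemma partialDeriv_sub (α : Fin n → ℕ) {f g : (𝔼 n) → ℝ} (hf : ContDiff ℝ (⊤ : ℕ∞) f)
    (hg : ContDiff ℝ (⊤ : ℕ∞) g) (x : 𝔼 n) :
    partialDeriv α (f - g) x = partialDeriv α f x - partialDeriv α g x := by
  obtain ⟨w, hw, h⟩ := exists_partialDeriv_eq α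
  rw [h f hf, h g hg, h (f - g) (hf.sub hg)]
  have e := iteratedFDeriv_sub_apply (i := deg α)
    ((hf.of_le (by exact_mod_cast le_top)).contDiffAt (x := x))
    ((hg.of_le (by exact_mod_cast le_top)).contDiffAt (x := x))
  simp only [e]
  rfl

/-- The differential is the sum of the `∂_i f` times the coordinate projections, which have norm at
most one. -/
lemma norm_iteratedFDeriv_succ_le (k : ℕ) {f : (𝔼 n) → ℝ} (hf : ContDiff ℝ (⊤ : ℕ∞) f)
    (x : 𝔼 n) :
    ‖iteratedFDeriv ℝ (k + 1) f x‖ ≤ ∑ i, ‖iteratedFDeriv ℝ k (coordDeriv i f) x‖ := by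
  have hp : ∀ i : Fin n, ‖(EuclideanSpace.proj i : (𝔼 n) →L[ℝ] ℝ)‖ ≤ 1 := fun i =>
    ContinuousLinearMap.opNorm_le_bound _ zero_le_one fun v => by
      rw [one_mul]
      exact PiLp.norm_apply_le v i
  have e : fderiv ℝ f = fun y => ∑ i, (ContinuousLinearMap.toSpanSingleton ℝ
      (EuclideanSpace.proj i : (𝔼 n) →L[ℝ] ℝ) ∘ coordDeriv i f) y := by
    funext y
    ext v
    have hv : v = ∑ i, v i • EuclideanSpace.single i (1 : ℝ) := by
      ext j
      simp [Pi.single_apply]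
    conv_lhs => rw [hv]
    simp [coordDeriv, mul_comm]
  have hle : (k : WithTop ℕ∞) ≤ ((⊤ : ℕ∞) : WithTop ℕ∞) := by exact_mod_cast le_top
  rw [← norm_iteratedFDeriv_fderiv, e, iteratedFDeriv_fun_sum_apply fun i _ =>
    (((ContinuousLinearMap.contDiff _).comp (coordDeriv_contDiff i hf)).of_le hle).contDiffAt]
  refine norm_sum_le_of_le _ fun i _ => ?_
  refine (ContinuousLinearMap.norm_iteratedFDeriv_comp_left _
    (coordDeriv_contDiff i hf).contDiffAt hle).trans
    (mul_le_of_le_one_left (norm_nonneg _) ?_)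
  rw [ContinuousLinearMap.norm_toSpanSingleton]
  exact hp i

/-! ### Taylor polynomials of formal jets -/

/-- The polynomial `∑_{|β| < q} (x - b)^β / β! * c β`. -/
noncomputable def taylorPoly (c : (Fin n → ℕ) → ℝ) (q : ℕ) (b x : 𝔼 n) : ℝ :=
  ∑ k ∈ Finset.range q, ∑ β ∈ Finset.piAntidiag Finset.univ k,
    (∏ i, (x i - b i) ^ β i) / (∏ i, ((β i).factorial : ℝ)) * c β

lemma deg_add (α β : Fin n → ℕ) : deg (α + β) = deg α + deg β := by
  simp [deg, Finset.sum_add_distrib]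

lemma deg_single (i : Fin n) (m : ℕ) : deg (Pi.single i m : Fin n → ℕ) = m := by
  simp [deg]

lemma deg_of_mem {k : ℕ} {β : Fin n → ℕ} (h : β ∈ Finset.piAntidiag Finset.univ k) :
    deg β = k := (Finset.mem_piAntidiag.1 h).1

lemma contDiff_coord (i : Fin n) : ContDiff ℝ (⊤ : ℕ∞) fun x : 𝔼 n => x i :=
  (EuclideanSpace.proj i : (𝔼 n) →L[ℝ] ℝ).contDiff

lemma contDiff_monomial (b : 𝔼 n) (β : Fin n → ℕ) : ContDiff ℝ (⊤ : ℕ∞) fun x : 𝔼 n =>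
    (∏ i, (x i - b i) ^ β i) / (∏ i, ((β i).factorial : ℝ)) :=
  (contDiff_prod fun i _ => ((contDiff_coord i).sub contDiff_const).pow _).div_const _

lemma contDiff_taylorPoly (c : (Fin n → ℕ) → ℝ) (q : ℕ) (b : 𝔼 n) :
    ContDiff ℝ (⊤ : ℕ∞) (taylorPoly c q b) :=
  ContDiff.sum fun _ _ => ContDiff.sum fun β _ => (contDiff_monomial b β).mul contDiff_const

lemma coordDeriv_monomial (b : 𝔼 n) (β : Fin n → ℕ) (i : Fin n) (x : 𝔼 n) :
    fderiv ℝ (fun x : 𝔼 n => (∏ j, (x j - b j) ^ β j) / (∏ j, ((β j).factorial : ℝ))) x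
      (EuclideanSpace.single i 1) =
    (∏ j ∈ Finset.univ.erase i, (x j - b j) ^ β j) * (β i * (x i - b i) ^ (β i - 1)) /
      (∏ j, ((β j).factorial : ℝ)) := by
  have h1 : ∀ j, HasFDerivAt (fun x : 𝔼 n => (x j - b j) ^ β j)
      ((β j * (x j - b j) ^ (β j - 1)) • (EuclideanSpace.proj j : (𝔼 n) →L[ℝ] ℝ)) x := fun j => by
    have := (((EuclideanSpace.proj j : (𝔼 n) →L[ℝ] ℝ).hasFDerivAt (x := x)).sub_const (b j)).pow
      (β j)
    rw [nsmul_eq_mul] at this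
    exact this
  have h2 := HasFDerivAt.finsetProd (u := Finset.univ) fun j _ => h1 j
  have h3 := (h2.mul_const (∏ j, ((β j).factorial : ℝ))⁻¹).fderiv
  simp only [div_eq_mul_inv]
  rw [h3]
  simp only [smul_apply, sum_apply]
  rw [Finset.sum_eq_single i]
  · simp
    ring
  · intro j _ hj
    simp [hj]
  · simp

lemma single_one_le {β : Fin n → ℕ} {i : Fin n} (hi : β i ≠ 0) : Pi.single i 1 ≤ β := fun j => by
  rcases eq_or_ne j i with rfl | h
  · simpa using Nat.one_le_iff_ne_zero.2 hi
  · simp [h]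

/-- In divided powers, differentiation merely shifts the coefficients. Taylor polynomials are thus
closed under partial derivatives, and bounds on their values give bounds on all derivatives. -/
lemma coordDeriv_taylorPoly (c : (Fin n → ℕ) → ℝ) (q : ℕ) (b : 𝔼 n) (i : Fin n) :
    coordDeriv i (taylorPoly c q b) =
      taylorPoly (fun β => c (β + Pi.single i 1)) (q - 1) b := by
  funext x
  have hdiff : ∀ β : Fin n → ℕ, DifferentiableAt ℝ (fun x : 𝔼 n =>
      (∏ i, (x i - b i) ^ β i) / (∏ i, ((β i).factorial : ℝ)) * c β) x := fun β =>
    (((contDiff_monomial b β).mul contDiff_const).differentiable (by simp)).differentiableAt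
  have e : fderiv ℝ (taylorPoly c q b) x = ∑ k ∈ Finset.range q,
      ∑ β ∈ Finset.piAntidiag Finset.univ k, c β • fderiv ℝ (fun x : 𝔼 n =>
      (∏ i, (x i - b i) ^ β i) / (∏ i, ((β i).factorial : ℝ))) x := by
    unfold taylorPoly
    rw [fderiv_fun_sum fun k _ => DifferentiableAt.fun_sum fun β _ => hdiff β]
    refine Finset.sum_congr rfl fun k _ => ?_
    rw [fderiv_fun_sum fun β _ => hdiff β]
    refine Finset.sum_congr rfl fun β _ => ?_
    rw [fderiv_mul_const ((contDiff_monomial b β).differentiable (by simp)).differentiableAt]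
  rw [coordDeriv, e]
  simp only [sum_apply, smul_apply, coordDeriv_monomial]
  cases q with
  | zero => simp [taylorPoly]
  | succ q =>
    rw [Finset.sum_range_succ', taylorPoly]
    simp only [add_tsub_cancel_right]
    have h0 : ∑ β ∈ Finset.piAntidiag (Finset.univ : Finset (Fin n)) 0,
        c β • ((∏ j ∈ Finset.univ.erase i, (x j - b j) ^ β j) *
          (β i * (x i - b i) ^ (β i - 1)) / (∏ j, ((β j).factorial : ℝ))) = 0 := by
      refine Finset.sum_eq_zero fun β hβ => ?_
      have h1 : β i ≤ 0 := by
        rw [← deg_of_mem hβ]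
        exact Finset.single_le_sum (fun _ _ => Nat.zero_le _) (Finset.mem_univ i)
      simp [Nat.le_zero.1 h1]
    rw [h0, add_zero]
    refine Finset.sum_congr rfl fun k _ => Eq.symm ?_
    -- The exponents `β` outside the image are those with `β i = 0`, whose monomials have zero
    -- derivative.
    refine Finset.sum_of_injOn (fun γ => γ + Pi.single i 1)
      (fun _ _ _ _ h => add_right_cancel h) (fun γ hγ => ?_) (fun β hβ hn => ?_) fun γ hγ => ?_
    · have : deg γ = k := deg_of_mem hγ
      refine Finset.mem_coe.2 (Finset.mem_piAntidiag.2 ⟨?_, by simp⟩)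
      change deg (γ + Pi.single i 1) = k + 1
      rw [deg_add, this, deg_single]
    · have hi : β i = 0 := by
        by_contra hi
        refine hn ⟨β - Pi.single i 1, ?_, ?_⟩
        · have hd : deg β = k + 1 := deg_of_mem hβ
          have hs : β - Pi.single i 1 + Pi.single i 1 = β :=
            tsub_add_cancel_of_le (single_one_le hi)
          have : deg (β - Pi.single i 1) = k := by
            have := deg_add (β - Pi.single i 1) (Pi.single i 1)
            rw [hs, hd, deg_single] at this
            omega
          exact Finset.mem_coe.2 (Finset.mem_piAntidiag.2 ⟨this, by simp⟩)
        · exact tsub_add_cancel_of_le (single_one_le hi)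
      simp [hi]
    · beta_reduce
      generalize hβ : γ + Pi.single i 1 = β
      have p1 : ∏ j ∈ Finset.univ.erase i, (x j - b j) ^ β j =
          ∏ j ∈ Finset.univ.erase i, (x j - b j) ^ γ j :=
        Finset.prod_congr rfl fun j hj => by simp [← hβ, Finset.ne_of_mem_erase hj]
      have p2 : ∏ j ∈ Finset.univ.erase i, ((β j).factorial : ℝ) =
          ∏ j ∈ Finset.univ.erase i, ((γ j).factorial : ℝ) :=
        Finset.prod_congr rfl fun j hj => by simp [← hβ, Finset.ne_of_mem_erase hj]
      have p3 : β i = γ i + 1 := by simp [← hβ]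
      rw [p1, ← Finset.mul_prod_erase Finset.univ _ (Finset.mem_univ i),
        ← Finset.mul_prod_erase Finset.univ (fun j => ((γ j).factorial : ℝ)) (Finset.mem_univ i),
        ← Finset.mul_prod_erase Finset.univ (fun j => ((β j).factorial : ℝ))
          (Finset.mem_univ i), p2, p3]
      simp only [add_tsub_cancel_right, Nat.factorial_succ, smul_eq_mul]
      have f1 : ((γ i).factorial : ℝ) ≠ 0 := by positivity
      have f2 : (∏ j ∈ Finset.univ.erase i, ((γ j).factorial : ℝ)) ≠ 0 :=
        Finset.prod_ne_zero_iff.2 fun j _ => by positivity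
      push_cast
      field_simp

lemma iterate_coordDeriv_taylorPoly (c : (Fin n → ℕ) → ℝ) (q : ℕ) (b : 𝔼 n) (i : Fin n) (m : ℕ) :
    (coordDeriv i)^[m] (taylorPoly c q b) =
      taylorPoly (fun β => c (β + Pi.single i m)) (q - m) b := by
  induction m with
  | zero => simp
  | succ m ih =>
    rw [Function.iterate_succ_apply', ih, coordDeriv_taylorPoly, Nat.sub_sub]
    congr 1
    funext β
    rw [add_assoc, ← Pi.single_add, add_comm 1 m]

lemma partialDeriv_taylorPoly (α : Fin n → ℕ) (c : (Fin n → ℕ) → ℝ) (q : ℕ) (b : 𝔼 n) :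
    partialDeriv α (taylorPoly c q b) = taylorPoly (fun β => c (β + α)) (q - deg α) b := by
  have key : ∀ l : List (Fin n), l.foldr (fun i g => (coordDeriv i)^[α i] g) (taylorPoly c q b) =
      taylorPoly (fun β => c (β + (l.map fun i => Pi.single i (α i)).sum))
        (q - (l.map α).sum) b := by
    intro l
    induction l with
    | nil => simp
    | cons i l ih =>
      rw [List.foldr_cons, ih, iterate_coordDeriv_taylorPoly, List.map_cons, List.sum_cons,
        List.map_cons, List.sum_cons, Nat.sub_sub, add_comm (α i)]
      congr 1
      funext β
      rw [add_assoc]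
  have e1 : ((List.finRange n).map α).sum = deg α := by
    rw [deg, ← List.ofFn_eq_map, List.sum_ofFn]
  have e2 : ((List.finRange n).map fun i => Pi.single i (α i) : List (Fin n → ℕ)).sum = α := by
    rw [← List.ofFn_eq_map, List.sum_ofFn, Finset.univ_sum_single]
  rw [partialDeriv, key, e1, e2]

lemma taylorPoly_self (c : (Fin n → ℕ) → ℝ) {q : ℕ} (hq : 0 < q) (b : 𝔼 n) :
    taylorPoly c q b b = c 0 := by
  rw [taylorPoly, Finset.sum_eq_single_of_mem 0 (Finset.mem_range.2 hq)]
  · simp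
  · intro k _ hk
    refine Finset.sum_eq_zero fun β hβ => ?_
    have : ∃ i, β i ≠ 0 := by
      by_contra h
      push Not at h
      exact hk ((deg_of_mem hβ).symm.trans (by simp [deg, h]))
    obtain ⟨i, hi⟩ := this
    rw [Finset.prod_eq_zero (Finset.mem_univ i) (by simp [hi])]
    simp

lemma partialDeriv_taylorPoly_self (α : Fin n → ℕ) (c : (Fin n → ℕ) → ℝ) {q : ℕ}
    (hq : deg α < q) (b : 𝔼 n) : partialDeriv α (taylorPoly c q b) b = c α := by
  rw [partialDeriv_taylorPoly, taylorPoly_self _ (by omega), zero_add]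

lemma taylorPoly_sub (c d : (Fin n → ℕ) → ℝ) (q : ℕ) (b : 𝔼 n) :
    taylorPoly c q b - taylorPoly d q b = taylorPoly (fun β => c β - d β) q b := by
  funext x
  simp only [taylorPoly, Pi.sub_apply, ← Finset.sum_sub_distrib, mul_sub]

lemma taylorPoly_congr {c d : (Fin n → ℕ) → ℝ} {q : ℕ} (h : ∀ β, deg β < q → c β = d β)
    (b : 𝔼 n) : taylorPoly c q b = taylorPoly d q b := by
  funext x
  refine Finset.sum_congr rfl fun k hk => Finset.sum_congr rfl fun β hβ => ?_
  rw [h β (by rw [deg_of_mem hβ]; exact Finset.mem_range.1 hk)]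

/-- Padding by zero coefficients allows polynomials of different degrees to be subtracted
coefficientwise. -/
lemma taylorPoly_truncate (c : (Fin n → ℕ) → ℝ) {p q : ℕ} (h : p ≤ q) (b : 𝔼 n) :
    taylorPoly c p b = taylorPoly (fun β => if deg β < p then c β else 0) q b := by
  funext x
  obtain ⟨d, rfl⟩ := Nat.exists_eq_add_of_le h
  simp only [taylorPoly]
  rw [Finset.sum_range_add _ p d]
  have h2 : ∑ k ∈ Finset.range d, ∑ β ∈ Finset.piAntidiag (Finset.univ : Finset (Fin n)) (p + k),
      (∏ i, (x i - b i) ^ β i) / (∏ i, ((β i).factorial : ℝ)) *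
        (if deg β < p then c β else 0) = 0 := by
    refine Finset.sum_eq_zero fun k _ => Finset.sum_eq_zero fun β hβ => ?_
    rw [if_neg (by rw [deg_of_mem hβ]; omega), mul_zero]
  rw [h2, add_zero]
  refine Finset.sum_congr rfl fun k hk => Finset.sum_congr rfl fun β hβ => ?_
  rw [if_pos (by rw [deg_of_mem hβ]; exact Finset.mem_range.1 hk)]

/-- The Taylor expansion of `taylorPoly c q a` at another point. -/
lemma taylorPoly_recenter (q : ℕ) (c : (Fin n → ℕ) → ℝ) (a b : 𝔼 n) :
    taylorPoly c q a =
      taylorPoly (fun β => taylorPoly (fun γ => c (β + γ)) (q - deg β) a b) q b := by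
  induction q generalizing c with
  | zero => funext x; simp [taylorPoly]
  | succ q ih =>
    set d : (Fin n → ℕ) → ℝ := fun β => taylorPoly (fun γ => c (β + γ)) (q + 1 - deg β) a b
      with hd
    have h1 := contDiff_taylorPoly c (q + 1) a
    have h2 := contDiff_taylorPoly d (q + 1) b
    -- The partial derivatives agree by the induction hypothesis for the shifted coefficients, so
    -- the two polynomials differ by a constant, which vanishes at `b`.
    have hcoord : ∀ i, coordDeriv i (taylorPoly c (q + 1) a) =
        coordDeriv i (taylorPoly d (q + 1) b) := fun i => by
      rw [coordDeriv_taylorPoly, coordDeriv_taylorPoly, Nat.add_sub_cancel, ih]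
      congr 1
      funext β
      rw [hd]
      simp only [deg_add, deg_single, Nat.add_sub_add_right]
      congr 1
      funext γ
      congr 1
      abel
    have hf : ∀ x, fderiv ℝ (taylorPoly c (q + 1) a - taylorPoly d (q + 1) b) x = 0 := fun x => by
      rw [fderiv_sub (h1.differentiable (by simp)).differentiableAt
        (h2.differentiable (by simp)).differentiableAt, sub_eq_zero]
      ext v
      have hv : v = ∑ i, v i • EuclideanSpace.single i (1 : ℝ) := by
        ext j
        simp [Pi.single_apply]
      rw [hv, map_sum, map_sum]
      refine Finset.sum_congr rfl fun i _ => ?_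
      rw [map_smul, map_smul]
      exact congrArg _ (congrFun (hcoord i) x)
    funext x
    have h3 : taylorPoly c (q + 1) a x - taylorPoly d (q + 1) b x =
        taylorPoly c (q + 1) a b - taylorPoly d (q + 1) b b :=
      is_const_of_fderiv_eq_zero ((h1.sub h2).differentiable (by simp)) hf x b
    rw [taylorPoly_self d (Nat.succ_pos q)] at h3
    have h4 : d 0 = taylorPoly c (q + 1) a b := by
      rw [hd]
      simp [deg]
    linarith

/-! ### Bounds for Taylor polynomials -/

/-- This is the multinomial theorem for `(1 + ⋯ + 1) ^ k`. -/
lemma sum_factorial_div (k : ℕ) : ∑ β ∈ Finset.piAntidiag (Finset.univ : Finset (Fin n)) k,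
    (k.factorial : ℝ) / (∏ i, ((β i).factorial : ℝ)) = (n : ℝ) ^ k := by
  have h := Finset.sum_pow_eq_sum_piAntidiag (Finset.univ : Finset (Fin n)) (fun _ => (1 : ℝ)) k
  simp only [Finset.sum_const, Finset.card_univ, Fintype.card_fin, nsmul_eq_mul, mul_one, one_pow,
    Finset.prod_const_one] at h
  rw [h]
  refine Finset.sum_congr rfl fun β hβ => ?_
  have := Nat.multinomial_spec Finset.univ β
  rw [show ∑ i, β i = k from deg_of_mem hβ] at this
  have hp : (∏ i, ((β i).factorial : ℝ)) ≠ 0 := Finset.prod_ne_zero_iff.2 fun j _ => by positivity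
  rw [div_eq_iff hp, mul_comm]
  exact_mod_cast this.symm

lemma factorial_add_le (j k : ℕ) :
    ((j + k).factorial : ℝ) ≤ 2 ^ (j + k) * (j.factorial * k.factorial) := by
  have h1 := Nat.add_choose_mul_factorial_mul_factorial j k
  rw [Nat.choose_symm_add.symm] at h1
  have h2 : (j + k).choose j ≤ 2 ^ (j + k) := Nat.choose_le_two_pow _ _
  calc ((j + k).factorial : ℝ) = ((j + k).choose j : ℝ) * (j.factorial * k.factorial) := by
        rw [← h1]; push_cast; ring
    _ ≤ _ := by gcongr; exact_mod_cast h2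

/-- The estimate `(k + m)! ≤ 2 ^ (k + m) * k! * m!` separates the shift `m` from the degree, and
summing `k! / β!` over `|β| = k` leaves a geometric sum. The shift `m` is there for derivatives:
each one raises it by one. -/
lemma abs_taylorPoly_le {c : (Fin n → ℕ) → ℝ} {q m : ℕ} {b x : 𝔼 n} {A ρ R B : ℝ} (hA : 0 ≤ A)
    (hρ : 0 ≤ ρ) (hR : 0 ≤ R) (hx : ‖x - b‖ ≤ R)
    (hc : ∀ β, |c β| ≤ A * (deg β + m).factorial * ρ ^ (deg β + m))
    (hB : ∑ j ∈ Finset.range q, (2 * n * R * ρ) ^ j ≤ B) :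
    |taylorPoly c q b x| ≤ A * m.factorial * (2 * ρ) ^ m * B := by
  have hcoord : ∀ i, |x i - b i| ≤ R := fun i => (PiLp.norm_apply_le (x - b) i).trans hx
  refine le_trans ?_ (mul_le_mul_of_nonneg_left hB (by positivity))
  rw [taylorPoly, Finset.mul_sum]
  refine (Finset.abs_sum_le_sum_abs _ _).trans (Finset.sum_le_sum fun k _ => ?_)
  refine (Finset.abs_sum_le_sum_abs _ _).trans ?_
  have hterm : ∀ β ∈ Finset.piAntidiag (Finset.univ : Finset (Fin n)) k,
      |(∏ i, (x i - b i) ^ β i) / (∏ i, ((β i).factorial : ℝ)) * c β| ≤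
        (k.factorial : ℝ) / (∏ i, ((β i).factorial : ℝ)) *
          (R ^ k * A * 2 ^ (k + m) * m.factorial * ρ ^ (k + m)) := fun β hβ => by
    have hd := deg_of_mem hβ
    have hp : 0 < ∏ i, ((β i).factorial : ℝ) := Finset.prod_pos fun j _ => by positivity
    have h1 : |∏ i, (x i - b i) ^ β i| ≤ R ^ k := by
      rw [Finset.abs_prod, ← hd, deg, ← Finset.prod_pow_eq_pow_sum]
      refine Finset.prod_le_prod (fun _ _ => abs_nonneg _) fun i _ => ?_
      rw [abs_pow]
      exact pow_le_pow_left₀ (abs_nonneg _) (hcoord i) _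
    have h2 := hc β
    rw [hd] at h2
    rw [abs_mul, abs_div, abs_of_pos hp]
    calc _ ≤ R ^ k / (∏ i, ((β i).factorial : ℝ)) *
          (A * (2 ^ (k + m) * (k.factorial * m.factorial)) * ρ ^ (k + m)) := by
          gcongr
          refine h2.trans ?_
          gcongr
          exact factorial_add_le k m
      _ = _ := by ring
  refine (Finset.sum_le_sum hterm).trans (le_of_eq ?_)
  rw [← Finset.sum_mul, sum_factorial_div]
  rw [mul_pow, mul_pow, mul_pow, mul_pow, pow_add, pow_add]
  ring

lemma norm_iteratedFDeriv_taylorPoly_le {b x : 𝔼 n} {A ρ R B : ℝ} (hA : 0 ≤ A)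
    (hρ : 0 ≤ ρ) (hR : 0 ≤ R) (hx : ‖x - b‖ ≤ R) (k : ℕ) :
    ∀ (m q : ℕ) (c : (Fin n → ℕ) → ℝ),
    (∀ β, |c β| ≤ A * (deg β + m).factorial * ρ ^ (deg β + m)) →
    ∑ j ∈ Finset.range q, (2 * n * R * ρ) ^ j ≤ B →
    ‖iteratedFDeriv ℝ k (taylorPoly c q b) x‖ ≤
      (n : ℝ) ^ k * (A * (m + k).factorial * (2 * ρ) ^ (m + k) * B) := by
  induction k with
  | zero =>
    intro m q c hc hB
    rw [norm_iteratedFDeriv_zero, Real.norm_eq_abs]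
    simpa using abs_taylorPoly_le hA hρ hR hx hc hB
  | succ k ih =>
    intro m q c hc hB
    refine (norm_iteratedFDeriv_succ_le k (contDiff_taylorPoly c q b) x).trans ?_
    have h : ∀ i, ‖iteratedFDeriv ℝ k (coordDeriv i (taylorPoly c q b)) x‖ ≤
        (n : ℝ) ^ k * (A * (m + 1 + k).factorial * (2 * ρ) ^ (m + 1 + k) * B) := fun i => by
      rw [coordDeriv_taylorPoly]
      refine ih (m + 1) (q - 1) _ (fun β => ?_) (le_trans ?_ hB)
      · have := hc (β + Pi.single i 1)
        rwa [deg_add, deg_single, add_assoc, add_comm 1 m] at this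
      · exact Finset.sum_le_sum_of_subset_of_nonneg
          (Finset.range_subset_range.2 (Nat.sub_le _ _)) fun _ _ _ => by positivity
    refine (Finset.sum_le_sum fun i _ => h i).trans (le_of_eq ?_)
    rw [Finset.sum_const, Finset.card_univ, Fintype.card_fin, nsmul_eq_mul,
      show m + (k + 1) = m + 1 + k by ring, pow_succ (n : ℝ) k]
    ring

/-! ### Comparison of the Taylor polynomials of a Whitney jet -/

/-- Whitney jets with respect to the sequence `k! * invProd r k`. -/
structure JetBound {E : Set (𝔼 n)} (F : JetFamily E) (r : ℕ → ℝ) (C ρ : ℝ) : Prop where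
  coeff : ∀ (α : Fin n → ℕ) (a : E),
    |F α a| ≤ C * ρ ^ deg α * ((deg α).factorial * invProd r (deg α))
  remainder : ∀ (p : ℕ) (α : Fin n → ℕ), deg α ≤ p → ∀ a b : E,
    |jetRemainder F p α a b| ≤ C * ρ ^ (p + 1) * ((p + 1).factorial * invProd r (p + 1)) *
      (‖b.1 - a.1‖ ^ (p + 1 - deg α) / ((p + 1 - deg α).factorial : ℝ))

/-- The Taylor polynomial of degree `< q` of the jet `F` at `a`. -/
noncomputable def jetPoly {E : Set (𝔼 n)} (F : JetFamily E) (q : ℕ) (a : E) : (𝔼 n) → ℝ :=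
  taylorPoly (fun β => F β a) q a.1

lemma contDiff_jetPoly {E : Set (𝔼 n)} (F : JetFamily E) (q : ℕ) (a : E) :
    ContDiff ℝ (⊤ : ℕ∞) (jetPoly F q a) := contDiff_taylorPoly _ _ _

lemma sum_pow_le_one_add_pow {x : ℝ} (hx : 0 ≤ x) (q : ℕ) :
    ∑ j ∈ Finset.range q, x ^ j ≤ (1 + x) ^ q := by
  induction q with
  | zero => simp
  | succ q ih =>
    rw [Finset.sum_range_succ, pow_succ, mul_add, mul_one]
    rcases q.eq_zero_or_pos with rfl | hq
    · simp [hx]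
    · refine add_le_add ih ?_
      obtain ⟨p, rfl⟩ := Nat.exists_eq_add_of_lt hq
      rw [zero_add, pow_succ]
      exact mul_le_mul_of_nonneg_right ((pow_le_pow_left₀ hx (by linarith) p).trans
        (pow_le_pow_right₀ (by linarith) p.le_succ)) hx

section

variable {E : Set (𝔼 n)} {F : JetFamily E} {r : ℕ → ℝ} {C ρ : ℝ} (hF : JetBound F r C ρ)
  (hr : IsNull r) (hC : 0 ≤ C) (hρ : 0 < ρ)

/-- Once the polynomial at `a` is expanded around `b`, the coefficients of the difference are
exactly the Whitney remainders of order `q - 1`. -/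
lemma jetPoly_sub_eq (F : JetFamily E) (q : ℕ) (a b : E) : jetPoly F q b - jetPoly F q a =
    taylorPoly (fun β => if deg β < q then jetRemainder F (q - 1) β a b else 0) q b.1 := by
  rw [jetPoly, jetPoly, taylorPoly_recenter q (fun β => F β a) a.1 b.1, taylorPoly_sub]
  refine taylorPoly_congr (fun β hβ => ?_) _
  rw [if_pos hβ, jetRemainder, show q - 1 - deg β + 1 = q - deg β by omega]
  rfl

include hF hr hC hρ

/-- Same degree, two base points. With `q! ≤ 2 ^ q * (q - |β|)! * |β|!` the remainders are bounded
by a constant times `|β|! * R⁻¹ ^ |β|`; the leftover power `R ^ q` will combine with `invProd r q`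
into the minimal weight. -/
lemma JetBound.norm_sub_base_le {R : ℝ} (hR : 0 < R) (q : ℕ) {a b : E} {x : 𝔼 n}
    (hxb : ‖x - b.1‖ ≤ R) (hab : ‖b.1 - a.1‖ ≤ R) (k : ℕ) :
    ‖iteratedFDeriv ℝ k (jetPoly F q b - jetPoly F q a) x‖ ≤
      C * invProd r q * (2 * ρ * (2 * n + 1) * R) ^ q * (k.factorial * (2 * n / R) ^ k) := by
  have hs := hr.invProd_pos q
  have hc : ∀ β : Fin n → ℕ, |if deg β < q then jetRemainder F (q - 1) β a b else 0| ≤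
      (C * (2 * ρ * R) ^ q * invProd r q) * (deg β + 0).factorial * (R⁻¹) ^ (deg β + 0) := by
    intro β
    split_ifs with h
    · have h1 := hF.remainder (q - 1) β (by omega) a b
      rw [Nat.sub_add_cancel (by omega : 1 ≤ q)] at h1
      have h2 := factorial_add_le (q - deg β) (deg β)
      rw [Nat.sub_add_cancel h.le] at h2
      have h3 : ‖b.1 - a.1‖ ^ (q - deg β) ≤ R ^ (q - deg β) :=
        pow_le_pow_left₀ (norm_nonneg _) hab _
      have h4 : (0 : ℝ) < (q - deg β).factorial := by positivity
      have h5 : R ^ q = R ^ (q - deg β) * R ^ deg β := by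
        rw [← pow_add, Nat.sub_add_cancel h.le]
      rw [add_zero]
      calc _ ≤ C * ρ ^ q * (q.factorial * invProd r q) *
            (‖b.1 - a.1‖ ^ (q - deg β) / ((q - deg β).factorial : ℝ)) := h1
        _ ≤ C * ρ ^ q * ((2 ^ q * ((q - deg β).factorial * (deg β).factorial)) * invProd r q) *
            (R ^ (q - deg β) / ((q - deg β).factorial : ℝ)) := by gcongr
        _ = _ := by
          rw [inv_pow, mul_pow, mul_pow, h5]
          field_simp
    · rw [abs_zero]
      positivity
  rw [jetPoly_sub_eq]
  have := norm_iteratedFDeriv_taylorPoly_le (n := n) (b := b.1) (x := x)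
    (A := C * (2 * ρ * R) ^ q * invProd r q) (ρ := R⁻¹) (R := R) (B := (2 * (n : ℝ) + 1) ^ q)
    (by positivity) (by positivity) hR.le hxb k 0 q _ hc (by
      have e : 2 * (n : ℝ) * R * R⁻¹ = 2 * n := by field_simp
      rw [e, add_comm]
      exact sum_pow_le_one_add_pow (by positivity) q)
  refine this.trans (le_of_eq ?_)
  rw [zero_add, div_eq_mul_inv]
  simp only [mul_pow]
  ring

/-- Same base point, two degrees. Only coefficients of degree between `q` and `cutIndex r t` remain,
and there `s_d t^d ≤ s_q t^q`; `hRt` makes the geometric sum have ratio at most `1 / 2`. -/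
lemma JetBound.norm_sub_order_le {R t : ℝ} (hR : 0 < R) (ht : 0 < t) (hRt : 4 * n * R * ρ ≤ t)
    {q : ℕ} (hq : q ≤ cutIndex r t) {b : E} {x : 𝔼 n} (hxb : ‖x - b.1‖ ≤ R) (k : ℕ) :
    ‖iteratedFDeriv ℝ k (jetPoly F (cutIndex r t) b - jetPoly F q b) x‖ ≤
      2 * C * (invProd r q * t ^ q) * (k.factorial * (2 * n * ρ / t) ^ k) := by
  have hs := hr.invProd_pos q
  set p := cutIndex r t with hp
  have e : jetPoly F p b - jetPoly F q b =
      taylorPoly (fun β => if deg β < p then (if deg β < q then 0 else F β b) else 0) p b.1 := by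
    rw [jetPoly, jetPoly, taylorPoly_truncate _ hq, taylorPoly_sub]
    refine taylorPoly_congr (fun β hβ => ?_) _
    rw [if_pos hβ]
    split_ifs <;> simp
  have hc : ∀ β : Fin n → ℕ, |if deg β < p then (if deg β < q then 0 else F β b) else 0| ≤
      (C * (invProd r q * t ^ q)) * (deg β + 0).factorial * (ρ / t) ^ (deg β + 0) := by
    intro β
    split_ifs with h h'
    · rw [abs_zero]
      positivity
    · have h1 := hF.coeff β b
      have h2 := hr.invProd_mul_pow_le ht (not_lt.1 h') h.le
      rw [add_zero]
      calc _ ≤ _ := h1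
        _ = C * (invProd r (deg β) * t ^ deg β) * (deg β).factorial * (ρ / t) ^ deg β := by
          rw [div_pow]; field_simp
        _ ≤ _ := by gcongr
    · rw [abs_zero]
      positivity
  rw [e]
  have := norm_iteratedFDeriv_taylorPoly_le (n := n) (b := b.1) (x := x)
    (A := C * (invProd r q * t ^ q)) (ρ := ρ / t) (R := R) (B := 2)
    (by positivity) (by positivity) hR.le hxb k 0 p _ hc (by
      have e : 2 * (n : ℝ) * R * (ρ / t) ≤ 1 / 2 := by
        rw [← mul_div_assoc, div_le_iff₀ ht]
        linarith
      refine (Finset.sum_le_sum fun j _ => pow_le_pow_left₀ (by positivity) e j).trans ?_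
      exact sum_geometric_two_le p)
  refine this.trans (le_of_eq ?_)
  rw [zero_add]
  simp only [mul_pow, div_pow]
  ring

/-- Taylor polynomials at nearby points whose degrees are adapted to the distance differ little. -/
lemma JetBound.norm_sub_le {R t t' : ℝ} (hR : 0 < R) (ht' : 0 < t') (htt : t' ≤ t)
    (htt2 : t ≤ 2 * t') (hRt : R * (8 * ρ * (n + 1)) = t) {a b : E} {x : 𝔼 n}
    (hxb : ‖x - b.1‖ ≤ R) (hab : ‖b.1 - a.1‖ ≤ R) (k : ℕ) :
    ‖iteratedFDeriv ℝ k (jetPoly F (cutIndex r t') b - jetPoly F (cutIndex r t) a) x‖ ≤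
      3 * C * minWeight r t * (k.factorial * (16 * n * (n + 1) * ρ / t) ^ k) := by
  have ht : 0 < t := ht'.trans_le htt
  have hn : (0 : ℝ) ≤ n := n.cast_nonneg
  set q := cutIndex r t with hq
  have hs := hr.invProd_pos q
  -- The degree is changed at `b`, then the base point at the fixed degree `q`.
  have e : jetPoly F (cutIndex r t') b - jetPoly F q a =
      (jetPoly F (cutIndex r t') b - jetPoly F q b) + (jetPoly F q b - jetPoly F q a) := by abel
  have hle : (k : WithTop ℕ∞) ≤ ((⊤ : ℕ∞) : WithTop ℕ∞) := by exact_mod_cast le_top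
  have c1 := (((contDiff_jetPoly F (cutIndex r t') b).sub (contDiff_jetPoly F q b)).of_le
    hle).contDiffAt (x := x)
  have c2 := (((contDiff_jetPoly F q b).sub (contDiff_jetPoly F q a)).of_le hle).contDiffAt (x := x)
  rw [e]
  refine (le_of_eq (congrArg norm (iteratedFDeriv_add_apply c1 c2))).trans
    ((norm_add_le _ _).trans ?_)
  have h1 := hF.norm_sub_order_le hr hC hρ hR ht' (by nlinarith [mul_pos hR hρ])
    (hr.cutIndex_anti ht' htt) hxb k
  have h2 := hF.norm_sub_base_le hr hC hρ hR q hxb hab k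
  have g1 : 2 * C * (invProd r q * t' ^ q) * (k.factorial * (2 * n * ρ / t') ^ k) ≤
      2 * C * minWeight r t * (k.factorial * (16 * n * (n + 1) * ρ / t) ^ k) := by
    have : 2 * n * ρ / t' ≤ 16 * n * (n + 1) * ρ / t := by
      rw [div_le_div_iff₀ ht' ht]
      have : 0 ≤ n * ρ * t' := by positivity
      have : 0 ≤ n * (n * ρ * t') := by positivity
      have : n * ρ * t ≤ n * ρ * (2 * t') := by gcongr
      nlinarith
    rw [minWeight, ← hq]
    gcongr
  have g2 : C * invProd r q * (2 * ρ * (2 * n + 1) * R) ^ q * (k.factorial * (2 * n / R) ^ k) ≤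
      C * minWeight r t * (k.factorial * (16 * n * (n + 1) * ρ / t) ^ k) := by
    have e1 : 2 * n / R = 16 * n * (n + 1) * ρ / t := by
      rw [← hRt]; field_simp; ring
    have e2 : 2 * ρ * (2 * n + 1) * R ≤ t := by
      rw [← hRt]; nlinarith [mul_pos hR hρ]
    rw [e1, minWeight, ← hq, mul_assoc C]
    gcongr
  calc _ ≤ _ := add_le_add h1 h2
    _ ≤ _ := add_le_add g1 g2
    _ = _ := by ring

end

/-! ### Partitions of unity on a grid -/

/-- On the grid `δ ℤⁿ` there are partitions of unity with controlled derivatives. -/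
lemma IsNonquasi.exists_partition {ν : ℕ → ℝ} (hν : IsNonquasi ν) {N : ℕ → ℝ} (hN0 : N 0 = 1)
    (hNpos : ∀ k, 0 < N k) (hmul : ∀ i j, N i * N j ≤ N (i + j))
    (hN : ∀ k, ∏ j ∈ Finset.range k, ν (j + 1) = N k) {K δ : ℝ} (hK : 0 < K) (hδ : 0 < δ) :
    ∃ Θ : (Fin n → ℤ) → (𝔼 n) → ℝ, (∀ k, ContDiff ℝ (⊤ : ℕ∞) (Θ k)) ∧
      (∀ k x, Θ k x ≠ 0 → ∀ i, |x i - δ * k i| ≤ 3 * δ) ∧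
      (∀ x (I : Finset (Fin n → ℤ)), (∀ k, Θ k x ≠ 0 → k ∈ I) → ∑ k ∈ I, Θ k x = 1) ∧
      ∀ k x, DerivBound N x ((2 * Real.exp 1 / minWeight (descRatio ν) (K * δ)) ^ n)
        (n * (2 * Real.exp 1 * K)) (Θ k) := by
  obtain ⟨g, hg, g0, g1, hgd⟩ := hν.exists_step hK hδ
  set H := minWeight (descRatio ν) (K * δ) with hH
  have hHpos : 0 < H := hν.isNull.minWeight_pos (mul_pos hK hδ)
  set κ := 2 * Real.exp 1 * K with hκ
  -- one-dimensional partition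
  set θ : ℤ → ℝ → ℝ := fun j x => g (x - δ * j) - g (x - δ * (j + 1)) with hθ
  have hθc : ∀ j, ContDiff ℝ (⊤ : ℕ∞) (θ j) := fun j =>
    (hg.comp (contDiff_id.sub contDiff_const)).sub (hg.comp (contDiff_id.sub contDiff_const))
  have hθs : ∀ j x, θ j x ≠ 0 → |x - δ * j| ≤ 3 * δ := fun j x h => by
    contrapose! h
    rcases lt_abs.1 h with h | h
    · simp only [hθ]
      rw [g1 _ (by linarith), g1 _ (by linarith), sub_self]
    · simp only [hθ]
      rw [g0 _ (by linarith), g0 _ (by linarith), sub_self]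
  have hθd : ∀ j k x, |iteratedDeriv k (θ j) x| ≤ 2 * Real.exp 1 / H * κ ^ k * N k :=
    fun j k x => by
    have hle : (k : WithTop ℕ∞) ≤ ((⊤ : ℕ∞) : WithTop ℕ∞) := by exact_mod_cast le_top
    have c : ∀ z : ℝ, ContDiffAt ℝ k (fun x => g (x - z)) x := fun z =>
      ((hg.comp (contDiff_id.sub contDiff_const)).of_le hle).contDiffAt
    have := iteratedDeriv_sub (c (δ * j)) (c (δ * (j + 1)))
    rw [iteratedDeriv_comp_sub_const, iteratedDeriv_comp_sub_const] at this
    refine (le_of_eq (congrArg abs this)).trans ((abs_sub _ _).trans ?_)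
    refine (add_le_add (hgd k _) (hgd k _)).trans (le_of_eq ?_)
    rw [hN]
    ring
  have hθsum : ∀ (z : ℤ) (m : ℕ) x, ∑ j ∈ Finset.range m, θ (z + j) x =
      g (x - δ * z) - g (x - δ * (z + m)) := fun z m x => by
    have := Finset.sum_range_sub' (fun j : ℕ => g (x - δ * (z + j))) m
    simp only [Nat.cast_zero, add_zero] at this
    rw [← this]
    refine Finset.sum_congr rfl fun j _ => ?_
    simp only [hθ]
    push_cast
    ring_nf
  have hθone : ∀ x : ℝ, ∃ s : Finset ℤ, ∀ s', s ⊆ s' → ∑ j ∈ s', θ j x = 1 := fun x => by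
    -- The seven integers from `z` on include every `j` with `θ j x ≠ 0`; their sum telescopes to a
    -- value of `g` right of `2 * δ` minus one left of `-δ`.
    set z : ℤ := ⌊x / δ⌋ - 3 with hz
    have hz1 : x / δ < ⌊x / δ⌋ + 1 := Int.lt_floor_add_one _
    have hz2 : (⌊x / δ⌋ : ℝ) ≤ x / δ := Int.floor_le _
    rw [div_lt_iff₀ hδ] at hz1
    rw [le_div_iff₀ hδ] at hz2
    refine ⟨(Finset.range 7).image fun j : ℕ => z + j, fun s' hs => ?_⟩
    rw [← Finset.sum_subset hs]
    · rw [Finset.sum_image (fun a _ b _ h => by simpa using h), hθsum, g1, g0, sub_zero]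
      · rw [hz]; push_cast; nlinarith
      · rw [hz]; push_cast; nlinarith
    · intro j _ hj
      by_contra h
      refine hj (Finset.mem_image.2 ⟨(j - z).toNat, ?_, ?_⟩)
      all_goals
        have h1 := abs_le.1 (hθs j x h)
        have h2 : (⌊x / δ⌋ : ℝ) - 3 ≤ j := by
          by_contra hc
          nlinarith
        have h3 : (j : ℝ) < ⌊x / δ⌋ + 4 := by
          by_contra hc
          nlinarith
        have h4 : ⌊x / δ⌋ - 3 ≤ j := by exact_mod_cast h2
        have h5 : j < ⌊x / δ⌋ + 4 := by exact_mod_cast h3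
      · rw [Finset.mem_range]; omega
      · omega
  refine ⟨fun k x => ∏ i, θ (k i) (x i), fun k => contDiff_prod fun i _ =>
    (hθc _).comp (contDiff_coord i), fun k x h i => hθs _ _ (Finset.prod_ne_zero_iff.1 h i
      (Finset.mem_univ i)), fun x I hI => ?_, fun k x => ?_⟩
  · choose s hs using hθone
    -- A box is needed to factor the sum of products into one-dimensional sums; it contains `I`, and
    -- the points outside `I` contribute nothing.
    set J := Fintype.piFinset fun i => s (x i) ∪ I.image fun k => k i
    have h1 : ∑ k ∈ J, ∏ i, θ (k i) (x i) = 1 := by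
      rw [← Finset.prod_univ_sum _ fun i j => θ j (x i)]
      exact Finset.prod_eq_one fun i _ => hs _ _ Finset.subset_union_left
    rw [← h1]
    refine Finset.sum_subset (fun k hk => Fintype.mem_piFinset.2 fun i =>
      Finset.mem_union_right _ (Finset.mem_image_of_mem _ hk)) fun k _ hk => ?_
    by_contra h
    exact hk (hI k h)
  · have hb : ∀ i, DerivBound N x (2 * Real.exp 1 / H) κ (fun y : 𝔼 n => θ (k i) (y i)) :=
      fun i m => by
      have hle : (m : WithTop ℕ∞) ≤ ((⊤ : ℕ∞) : WithTop ℕ∞) := by exact_mod_cast le_top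
      have e := (EuclideanSpace.proj i : (𝔼 n) →L[ℝ] ℝ).iteratedFDeriv_comp_right
        ((hθc (k i)).of_le hle) x (i := m) le_rfl
      have hp : ‖(EuclideanSpace.proj i : (𝔼 n) →L[ℝ] ℝ)‖ ≤ 1 :=
        ContinuousLinearMap.opNorm_le_bound _ zero_le_one fun v => by
          rw [one_mul]
          exact PiLp.norm_apply_le v i
      refine (le_of_eq (congrArg norm e)).trans
        ((ContinuousMultilinearMap.norm_compContinuousLinearMap_le _ _).trans ?_)
      refine (mul_le_of_le_one_right (norm_nonneg _)
        (Finset.prod_le_one (fun _ _ => norm_nonneg _) fun _ _ => hp)).trans ?_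
      rw [norm_iteratedFDeriv_eq_norm_iteratedDeriv]
      exact hθd _ _ _
    have := DerivBound.prod hNpos hmul Finset.univ hN0
      (fun i => (hθc (k i)).comp (contDiff_coord i)) (by positivity) (by positivity) hb
    simpa using this

/-! ### The extension -/

/-- The grid points `k` with `‖x - δ k‖_∞ ≤ 3 δ`. -/
noncomputable def gridNear (δ : ℝ) (x : 𝔼 n) : Finset (Fin n → ℤ) :=
  Fintype.piFinset fun i => Finset.Icc (⌊x i / δ⌋ - 3) (⌊x i / δ⌋ + 3)

lemma card_gridNear (δ : ℝ) (x : 𝔼 n) : (gridNear δ x).card = 7 ^ n := by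
  rw [gridNear, Fintype.card_piFinset]
  have : ∀ z : ℤ, (z + 3 + 1 - (z - 3)).toNat = 7 := fun z => by omega
  simp [this]

lemma mem_gridNear {δ : ℝ} (hδ : 0 < δ) {x : 𝔼 n} {k : Fin n → ℤ}
    (h : ∀ i, |x i - δ * k i| ≤ 3 * δ) : k ∈ gridNear δ x := by
  refine Fintype.mem_piFinset.2 fun i => Finset.mem_Icc.2 ?_
  have hz1 : x i / δ < ⌊x i / δ⌋ + 1 := Int.lt_floor_add_one _
  have hz2 : (⌊x i / δ⌋ : ℝ) ≤ x i / δ := Int.floor_le _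
  rw [div_lt_iff₀ hδ] at hz1
  rw [le_div_iff₀ hδ] at hz2
  have h1 := abs_le.1 (h i)
  have h2 : (⌊x i / δ⌋ : ℝ) - 3 ≤ k i := by
    by_contra hc
    nlinarith
  have h3 : (k i : ℝ) < ⌊x i / δ⌋ + 4 := by
    by_contra hc
    nlinarith
  have h4 : ⌊x i / δ⌋ - 3 ≤ k i := by exact_mod_cast h2
  have h5 : k i < ⌊x i / δ⌋ + 4 := by exact_mod_cast h3
  omega

/-- The margin `4 * δ` exceeds the support radius `3 * δ` so that the retained partition functions
sum to one on a whole neighbourhood of `E`, which is what permits comparing derivatives there. -/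
lemma finite_grid {E : Set (𝔼 n)} (hE : IsCompact E) {δ : ℝ} (hδ : 0 < δ) :
    {k : Fin n → ℤ | ∃ a : E, ∀ i, |a.1 i - δ * k i| ≤ 4 * δ}.Finite := by
  obtain ⟨B, hB⟩ := hE.isBounded.exists_norm_le
  set z : ℤ := ⌈B / δ⌉ + 4 with hz
  have hz1 : B / δ ≤ ⌈B / δ⌉ := Int.le_ceil _
  rw [div_le_iff₀ hδ] at hz1
  refine (Set.finite_Icc (fun _ : Fin n => -z) fun _ => z).subset ?_
  rintro k ⟨a, ha⟩
  have key : ∀ i, |k i| ≤ z := fun i => by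
    have h1 : |a.1 i| ≤ B := (PiLp.norm_apply_le a.1 i).trans (hB _ a.2)
    have h2 : |δ * k i| ≤ B + 4 * δ := by
      have := abs_sub_abs_le_abs_sub (δ * k i) (a.1 i)
      rw [abs_sub_comm] at this
      linarith [ha i]
    rw [abs_mul, abs_of_pos hδ] at h2
    have h3 : |(k i : ℝ)| ≤ z := by
      rw [hz]
      push_cast
      by_contra hc
      nlinarith
    exact_mod_cast h3
  exact ⟨fun i => (abs_le.1 (key i)).1, fun i => (abs_le.1 (key i)).2⟩

lemma norm_sub_le_of_coord {x y : 𝔼 n} {B : ℝ} (h : ∀ i, |x i - y i| ≤ B) : ‖x - y‖ ≤ n * B := by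
  have e : x - y = ∑ i, (x i - y i) • EuclideanSpace.single i (1 : ℝ) := by
    ext j
    simp [Pi.single_apply]
  rw [e]
  refine (norm_sum_le_of_le (f := fun i => (x i - y i) • EuclideanSpace.single i (1 : ℝ))
    (n := fun _ => B) _ fun i _ => ?_).trans (by simp)
  rw [norm_smul]
  simpa using h i

lemma norm_sub_le_of_grid {δ δ' : ℝ} {x y : 𝔼 n} {k : Fin n → ℤ}
    (hx : ∀ i, |x i - δ * k i| ≤ 3 * δ) (hy : ∀ i, |y i - δ * k i| ≤ 4 * δ) (h : δ ≤ δ') :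
    ‖x - y‖ ≤ n * (7 * δ') :=
  norm_sub_le_of_coord fun i => by
    have h1 := abs_sub_le (x i) (δ * k i) (y i)
    have h2 := hx i
    have h3 := hy i
    rw [abs_sub_comm] at h3
    linarith

-- The power `2 * n + 2` is spent as follows: `2 * n` factors cancel the losses of two cutoffs in
-- `n` variables, one turns `k! t^{-k}` into `N k`, and one remains to make the series converge.
set_option maxHeartbeats 1600000 in
theorem JetBound.exists_extension {E : Set (𝔼 n)} (hE : IsCompact E) (hne : E.Nonempty)
    {F : JetFamily E} {r : ℕ → ℝ} {C ρ : ℝ} (hF : JetBound F r C ρ) (hr : IsNull r) (hC : 0 ≤ C)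
    (hρ : 0 < ρ) {ν : ℕ → ℝ} (hν : IsNonquasi ν) {N : ℕ → ℝ} (hN0 : N 0 = 1)
    (hNpos : ∀ k, 0 < N k) (hmul : ∀ i j, N i * N j ≤ N (i + j))
    (hN : ∀ k, ∏ j ∈ Finset.range k, ν (j + 1) = N k) {D : ℝ} (hD : 0 < D)
    (hrν : ∀ t, 0 < t → minWeight r t ≤ minWeight (descRatio ν) (D * t) ^ (2 * n + 2)) :
    ∃ f : (𝔼 n) → ℝ, ContDiff ℝ (⊤ : ℕ∞) f ∧ (∀ α (a : E), partialDeriv α f a = F α a) ∧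
      ∃ A R : ℝ, 0 < R ∧ ∀ k x, ‖iteratedFDeriv ℝ k f x‖ ≤ A * R ^ k * N k := by
  classical
  have hn : (0 : ℝ) ≤ n := n.cast_nonneg
  -- the scales
  set L : ℝ := (14 * n + 1) * (8 * ρ * (n + 1)) with hL
  have hL0 : 0 < L := by positivity
  have hr0 := hr.pos 0
  set t : ℕ → ℝ := fun m => r 0 * (1 / 2) ^ m with ht
  have ht0 : ∀ m, 0 < t m := fun m => by positivity
  have htsucc : ∀ m, t (m + 1) = t m / 2 := fun m => by simp only [ht, pow_succ]; ring
  have htanti : Antitone t := antitone_nat_of_succ_le fun m => by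
    rw [htsucc]; linarith [ht0 m]
  have htlim : Tendsto t atTop (𝓝 0) := by
    have := (tendsto_pow_atTop_nhds_zero_of_lt_one (r := (1 / 2 : ℝ)) (by norm_num)
      (by norm_num)).const_mul (r 0)
    rwa [mul_zero] at this
  set δ : ℕ → ℝ := fun m => t m / L with hδd
  have hδ : ∀ m, 0 < δ m := fun m => div_pos (ht0 m) hL0
  have hδanti : Antitone δ := fun m m' h => div_le_div_of_nonneg_right (htanti h) hL0.le
  set r' := descRatio ν with hr'
  have hnull : IsNull r' := hν.isNull
  set H : ℕ → ℝ := fun m => minWeight r' (D * t m) with hH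
  have hH0 : ∀ m, 0 < H m := fun m => hnull.minWeight_pos (mul_pos hD (ht0 m))
  have hH1 : ∀ m, H m ≤ 1 := fun m => hnull.minWeight_le_one (mul_pos hD (ht0 m))
  -- The minimal weight is at most linear in its argument, and the scales are geometric.
  have hHsum : Summable H := by
    refine Summable.of_nonneg_of_le (fun m => (hH0 m).le)
      (fun m => hnull.minWeight_le_mul (mul_pos hD (ht0 m))) ?_
    exact (((summable_geometric_two).mul_left (r 0)).mul_left D).mul_left _
  -- the partitions of unity
  set K : ℝ := 2 * D * L with hK
  have hK0 : 0 < K := by positivity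
  set S : ℝ := n * (2 * Real.exp 1 * K) with hS
  have hS0 : 0 ≤ S := by positivity
  choose Θ hΘc hΘs hΘ1 hΘd using fun m => hν.exists_partition (n := n) hN0 hNpos hmul hN hK0 (hδ m)
  have hΘd' : ∀ j m k x, m ≤ j + 1 →
      DerivBound N x ((2 * Real.exp 1 / H j) ^ n) S (Θ m k) := fun j m k x h => by
    refine (hΘd m k x).mono hNpos ?_ (by have := hH0 j; positivity) hS0 le_rfl
    -- By the choice of `K`, `K * δ m = 2 * D * t m`; the factor 2 lets the cutoffs of the next
    -- finer scale also be bounded in terms of `H j`.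
    have h1 : D * t j ≤ K * δ m := by
      have e : K * δ m = D * (2 * t m) := by rw [hK, hδd]; field_simp
      rw [e]
      have := htanti h
      rw [htsucc] at this
      gcongr
      linarith
    have h2 : H j ≤ minWeight r' (K * δ m) := hnull.minWeight_mono (mul_pos hD (ht0 j)) h1
    have := hH0 j
    have := hnull.minWeight_pos (mul_pos hK0 (hδ m))
    gcongr
  have hΘ0 : ∀ m k x, (¬∀ i, |x i - δ m * k i| ≤ 3 * δ m) → Θ m k =ᶠ[𝓝 x] 0 := fun m k x hk => by
    push Not at hk
    obtain ⟨i, hi⟩ := hk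
    have hc : Continuous fun y : 𝔼 n => |y i - δ m * k i| :=
      ((contDiff_coord i).continuous.sub continuous_const).abs
    filter_upwards [hc.continuousAt.eventually (lt_mem_nhds hi)] with y hy
    by_contra h
    exact absurd (hΘs m k y h i) (not_le.2 hy)
  -- the index sets, the base points and the polynomials
  set I : ℕ → Finset (Fin n → ℤ) := fun m => (finite_grid hE (hδ m)).toFinset with hI
  have hbase : ∀ m (k : Fin n → ℤ), ∃ a : E, k ∈ I m → ∀ i, |a.1 i - δ m * k i| ≤ 4 * δ m :=
    fun m k => by
    by_cases h : k ∈ I m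
    · obtain ⟨a, ha⟩ := (finite_grid hE (hδ m)).mem_toFinset.1 h
      exact ⟨a, fun _ => ha⟩
    · exact ⟨⟨_, hne.some_mem⟩, fun h' => absurd h' h⟩
  choose c hc using hbase
  set q : ℕ → ℕ := fun m => cutIndex r (t m) with hq
  set P : ℕ → (Fin n → ℤ) → (𝔼 n) → ℝ := fun m k => jetPoly F (q m) (c m k) with hP
  have hPc : ∀ m k, ContDiff ℝ (⊤ : ℕ∞) (P m k) := fun m k => contDiff_jetPoly _ _ _
  -- differences of polynomials
  set T : ℝ := 16 * n * (n + 1) * ρ * D with hT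
  have hT0 : 0 ≤ T := by positivity
  have hdiff : ∀ m m' (a b : E) (x : 𝔼 n), m ≤ m' → m' ≤ m + 1 →
      ‖x - b.1‖ ≤ (14 * n + 1) * δ m → ‖b.1 - a.1‖ ≤ (14 * n + 1) * δ m →
      DerivBound N x (3 * C * H m ^ (2 * n + 1)) T (jetPoly F (q m') b - jetPoly F (q m) a) := by
    intro m m' a b x h1 h2 hxb hab k
    -- `L` was chosen for this identity. A point is within `7 * n * δ m` of each active base point,
    -- so two base points are within `14 * n * δ m`; adding one keeps the radius positive for `n =
    -- 0`.
    have e : (14 * n + 1) * δ m * (8 * ρ * (n + 1)) = t m := by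
      rw [hδd, hL]; field_simp
    have h3 := htanti h2
    rw [htsucc] at h3
    refine (hF.norm_sub_le hr hC hρ (by have := hδ m; positivity) (ht0 m') (htanti h1)
      (by linarith) e hxb hab k).trans ?_
    have h4 : minWeight r (t m) ≤ H m ^ (2 * n + 2) := hrν _ (ht0 m)
    have h5 : H m * (D * t m)⁻¹ ^ k ≤ invProd r' k :=
      hnull.minWeight_mul_inv_pow_le (mul_pos hD (ht0 m)) k
    have h6 : (k.factorial : ℝ) * invProd r' k ≤ N k := by
      rw [← hN]
      exact hν.factorial_mul_invProd_le k
    have e2 : 16 * n * (n + 1) * ρ / t m = T * (D * t m)⁻¹ := by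
      rw [hT]
      have := ht0 m
      field_simp
    have := hH0 m
    rw [e2, mul_pow]
    -- One factor `H m` is traded for the growth of the derivatives: `H m * (D * t m)⁻¹ ^ k ≤ s'_k`
    -- and `k! * s'_k ≤ N k`.
    calc 3 * C * minWeight r (t m) * (k.factorial * (T ^ k * (D * t m)⁻¹ ^ k))
        ≤ 3 * C * H m ^ (2 * n + 2) * (k.factorial * (T ^ k * (D * t m)⁻¹ ^ k)) := by
          have := ht0 m
          gcongr
      _ = 3 * C * H m ^ (2 * n + 1) * T ^ k * (k.factorial * (H m * (D * t m)⁻¹ ^ k)) := by ring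
      _ ≤ 3 * C * H m ^ (2 * n + 1) * T ^ k * (k.factorial * invProd r' k) := by gcongr
      _ ≤ _ := by gcongr
  -- the indices active at a point
  set J : ℕ → (𝔼 n) → Finset (Fin n → ℤ) := fun m x =>
    (I m).filter fun k => ∀ i, |x i - δ m * k i| ≤ 3 * δ m with hJ
  have hJcard : ∀ m x, (J m x).card ≤ 7 ^ n := fun m x => by
    rw [← card_gridNear (δ m) x]
    exact Finset.card_le_card fun k hk => mem_gridNear (hδ m) (Finset.mem_filter.1 hk).2
  have hJ0 : ∀ m x k, k ∈ I m → k ∉ J m x → Θ m k =ᶠ[𝓝 x] 0 := fun m x k hk hk' =>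
    hΘ0 m k x fun h => hk' (Finset.mem_filter.2 ⟨hk, h⟩)
  have hJdist : ∀ m j x k, j ≤ m → k ∈ J m x → ‖x - (c m k).1‖ ≤ n * (7 * δ j) :=
    fun m j x k hj hk => by
    obtain ⟨h1, h2⟩ := Finset.mem_filter.1 hk
    exact norm_sub_le_of_grid h2 (hc m k h1) (hδanti hj)
  -- the terms of the series
  set term : ℕ → (𝔼 n) → ℝ := fun m x => ∑ p ∈ I m ×ˢ I (m + 1),
    Θ m p.1 x * Θ (m + 1) p.2 x * (P (m + 1) p.2 - P m p.1) x with hterm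
  have htermc' : ∀ m (p : (Fin n → ℤ) × (Fin n → ℤ)), ContDiff ℝ (⊤ : ℕ∞) fun x =>
      Θ m p.1 x * Θ (m + 1) p.2 x * (P (m + 1) p.2 - P m p.1) x := fun m p =>
    ((hΘc _ _).mul (hΘc _ _)).mul ((hPc _ _).sub (hPc _ _))
  have htermc : ∀ m, ContDiff ℝ (⊤ : ℕ∞) (term m) := fun m => ContDiff.sum fun p _ => htermc' m p
  set R : ℝ := S + S + T + 1 with hR
  have hR0 : 0 < R := by positivity
  set A : ℝ := 7 ^ n * 7 ^ n * (3 * C * (2 * Real.exp 1) ^ (2 * n)) with hA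
  have hA0 : 0 ≤ A := by positivity
  -- The two cutoffs contribute `H m ^ (-2 n)` and the difference of polynomials `H m ^ (2 n + 1)`,
  -- leaving one summable factor `H m`; at most `7 ^ n` indices per scale are active.
  have htermd : ∀ m x, DerivBound N x (A * H m) R (term m) := fun m x => by
    have hHm := hH0 m
    have hsum := DerivBound.sum hNpos (x := x) (I m ×ˢ I (m + 1)) (J m x ×ˢ J (m + 1) x)
      (A := (2 * Real.exp 1 / H m) ^ n * (2 * Real.exp 1 / H m) ^ n *
        (3 * C * H m ^ (2 * n + 1))) (R := S + S + T)
      (f := fun p x => Θ m p.1 x * Θ (m + 1) p.2 x * (P (m + 1) p.2 - P m p.1) x)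
      (by positivity) (by positivity) (htermc' m) (fun p hp => by
        obtain ⟨h1, h2⟩ := Finset.mem_product.1 hp
        have d1 := hJdist m m x p.1 le_rfl h1
        have d2 := hJdist (m + 1) m x p.2 (Nat.le_succ m) h2
        have hδm := hδ m
        refine DerivBound.mul hNpos hmul ((hΘc _ _).mul (hΘc _ _)) ((hPc _ _).sub (hPc _ _))
          (by positivity) (by positivity) (by positivity) hT0
          (DerivBound.mul hNpos hmul (hΘc _ _) (hΘc _ _) (by positivity) (by positivity) hS0 hS0
            (hΘd' m m p.1 x (Nat.le_succ m)) (hΘd' m (m + 1) p.2 x le_rfl))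
          (hdiff m (m + 1) _ _ x (Nat.le_succ m) le_rfl (by nlinarith) ?_)
        have := norm_sub_le_norm_sub_add_norm_sub (c (m + 1) p.2).1 x (c m p.1).1
        rw [norm_sub_rev _ x] at this
        nlinarith) (fun p hp hp' => by
        obtain ⟨h1, h2⟩ := Finset.mem_product.1 hp
        by_cases h3 : p.1 ∈ J m x
        · have h4 : p.2 ∉ J (m + 1) x := fun h4 => hp' (Finset.mem_product.2 ⟨h3, h4⟩)
          filter_upwards [hJ0 _ _ _ h2 h4] with y hy
          simp [hy]
        · filter_upwards [hJ0 _ _ _ h1 h3] with y hy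
          simp [hy])
    refine hsum.mono hNpos ?_ (by positivity) (by positivity) (by rw [hR]; linarith)
    have hcard : ((J m x ×ˢ J (m + 1) x).card : ℝ) ≤ 7 ^ n * 7 ^ n := by
      rw [Finset.card_product]
      exact_mod_cast Nat.mul_le_mul (hJcard m x) (hJcard (m + 1) x)
    refine (mul_le_mul_of_nonneg_right hcard (by positivity)).trans (le_of_eq ?_)
    rw [hA, div_pow]
    field_simp
    ring
  have hv : ∀ k : ℕ, (k : ℕ∞) ≤ (⊤ : ℕ∞) → Summable fun m => A * H m * R ^ k * N k := fun k _ =>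
    ((hHsum.mul_left A).mul_right _).mul_right _
  have hvb : ∀ (k m : ℕ) (x : 𝔼 n), (k : ℕ∞) ≤ (⊤ : ℕ∞) →
      ‖iteratedFDeriv ℝ k (term m) x‖ ≤ A * H m * R ^ k * N k := fun k m x _ => htermd m x k
  have hfc : ContDiff ℝ (⊤ : ℕ∞) fun x => ∑' m, term m x := contDiff_tsum htermc hv hvb
  refine ⟨fun x => ∑' m, term m x, hfc, fun α a => ?_, A * ∑' m, H m, R, hR0, fun k x => ?_⟩
  · -- the jet on `E`
    set G : ℕ → (𝔼 n) → ℝ := fun m x => ∑ k ∈ I m, Θ m k x * P m k x with hG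
    set F' : ℕ → (𝔼 n) → ℝ := fun M x => ∑ m ∈ Finset.range M, term m x with hF'
    have hF'c : ∀ M, ContDiff ℝ (⊤ : ℕ∞) (F' M) := fun M => ContDiff.sum fun m _ => htermc m
    have hone : ∀ M, ∀ᶠ y in 𝓝 a.1, ∀ m ≤ M, ∑ k ∈ I m, Θ m k y = 1 := fun M => by
      have hc : ∀ i : Fin n, Continuous fun y : 𝔼 n => |y i - a.1 i| := fun i =>
        ((contDiff_coord i).continuous.sub continuous_const).abs
      have : ∀ᶠ y in 𝓝 a.1, ∀ i : Fin n, |y i - a.1 i| < δ M := eventually_all.2 fun i =>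
        (hc i).continuousAt.eventually (gt_mem_nhds (by simpa using hδ M))
      filter_upwards [this] with y hy m hm
      refine hΘ1 m y (I m) fun k hk => (finite_grid hE (hδ m)).mem_toFinset.2 ⟨a, fun i => ?_⟩
      have h1 := hΘs m k y hk i
      have h2 := abs_sub_le (a.1 i) (y i) (δ m * k i)
      have h3 := hy i
      have h4 := hδanti hm
      rw [abs_sub_comm] at h3
      linarith
    -- Because `t 0 = r 0`, the initial degree bound `q 0` is zero and the polynomials of the
    -- coarsest scale vanish; the telescoping sum has no initial term.
    have hG0 : ∀ x, G 0 x = 0 := fun x => by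
      have : q 0 = 0 := cutIndex_eq_zero (by simp [ht])
      simp [hG, hP, jetPoly, taylorPoly, this]
    have hlocal : ∀ M, F' M =ᶠ[𝓝 a.1] G M := fun M => by
      filter_upwards [hone M] with y hy
      have hst : ∀ m < M, term m y = G (m + 1) y - G m y := fun m hm => by
        have e1 := hy m hm.le
        have e2 := hy (m + 1) hm
        -- The double sum factors, and near `a` both partitions sum to one.
        calc term m y = (∑ k ∈ I m, Θ m k y) * G (m + 1) y -
              (∑ l ∈ I (m + 1), Θ (m + 1) l y) * G m y := by
              simp only [hterm, hG, Finset.sum_product, Finset.sum_mul_sum, Pi.sub_apply]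
              rw [Finset.sum_comm (s := I (m + 1)), ← Finset.sum_sub_distrib]
              refine Finset.sum_congr rfl fun k _ => ?_
              rw [← Finset.sum_sub_distrib]
              exact Finset.sum_congr rfl fun l _ => by ring
          _ = _ := by rw [e1, e2, one_mul, one_mul]
      simp only [hF']
      rw [Finset.sum_congr rfl fun m hm => hst m (Finset.mem_range.1 hm),
        Finset.sum_range_sub (fun m => G m y), hG0, sub_zero]
    have hrem : ∀ M, F' M - jetPoly F (q M) a =ᶠ[𝓝 a.1]
        fun x => ∑ k ∈ I M, Θ M k x * (P M k - jetPoly F (q M) a) x := fun M => by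
      filter_upwards [hlocal M, hone M] with y h1 h2
      rw [Pi.sub_apply, h1]
      simp only [hG, Pi.sub_apply, mul_sub, Finset.sum_sub_distrib]
      rw [← Finset.sum_mul, h2 M le_rfl, one_mul]
    have hremc : ∀ M k, ContDiff ℝ (⊤ : ℕ∞) fun x =>
        Θ M k x * (P M k - jetPoly F (q M) a) x := fun M k =>
      (hΘc M k).mul ((hPc M k).sub (contDiff_jetPoly _ _ _))
    -- Near `a` the difference is a weighted mean of differences of Taylor polynomials of the same
    -- degree; its derivatives at `a` are of size `H M`, hence tend to zero.
    have hremd : ∀ M, DerivBound N a.1 (7 ^ n * (3 * C * (2 * Real.exp 1) ^ n) * H M) (S + T)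
        (F' M - jetPoly F (q M) a) := fun M k => by
      have hHm := hH0 M
      have hsum := DerivBound.sum hNpos (x := a.1) (I M) (J M a.1)
        (A := (2 * Real.exp 1 / H M) ^ n * (3 * C * H M ^ (2 * n + 1))) (R := S + T)
        (f := fun k x => Θ M k x * (P M k - jetPoly F (q M) a) x)
        (by positivity) (by positivity) (hremc M) (fun p hp => by
          have d1 := hJdist M M a.1 p le_rfl hp
          have hδm := hδ M
          refine DerivBound.mul hNpos hmul (hΘc _ _) ((hPc _ _).sub (contDiff_jetPoly _ _ _))
            (by positivity) (by positivity) hS0 hT0 (hΘd' M M p a.1 (Nat.le_succ M))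
            (hdiff M M _ _ a.1 le_rfl (Nat.le_succ M) (by nlinarith) ?_)
          rw [norm_sub_rev]
          nlinarith) (fun p hp hp' => by
          filter_upwards [hJ0 _ _ _ hp hp'] with y hy
          simp [hy])
      rw [((hrem M).iteratedFDeriv ℝ k).eq_of_nhds]
      refine (hsum.mono hNpos ?_ (by positivity) (by positivity) le_rfl) k
      have hcard : ((J M a.1).card : ℝ) ≤ 7 ^ n := by exact_mod_cast hJcard M a.1
      have hpow : H M ^ n * H M ≤ H M := mul_le_of_le_one_left hHm.le (pow_le_one₀ hHm.le (hH1 M))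
      calc _ ≤ (7 : ℝ) ^ n * ((2 * Real.exp 1 / H M) ^ n * (3 * C * H M ^ (2 * n + 1))) :=
            mul_le_mul_of_nonneg_right hcard (by positivity)
        _ = 7 ^ n * (3 * C * (2 * Real.exp 1) ^ n) * (H M ^ n * H M) := by
            rw [div_pow]
            field_simp
            ring
        _ ≤ _ := by gcongr
    obtain ⟨w, -, hw⟩ := exists_partialDeriv_eq α
    have hlim1 : Tendsto (fun M => partialDeriv α (F' M) a) atTop
        (𝓝 (partialDeriv α (fun x => ∑' m, term m x) a)) := by
      rw [hw _ hfc]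
      have h1 : ∀ M, partialDeriv α (F' M) a.1 =
          (∑ m ∈ Finset.range M, iteratedFDeriv ℝ (deg α) (term m) a.1) w := fun M => by
        rw [hw _ (hF'c M)]
        simp only [hF']
        rw [iteratedFDeriv_fun_sum_apply fun m _ =>
          ((htermc m).of_le (by exact_mod_cast le_top)).contDiffAt]
      simp only [h1]
      rw [iteratedFDeriv_tsum_apply htermc hv hvb le_top a.1]
      have h2 : Summable fun m => iteratedFDeriv ℝ (deg α) (term m) a.1 :=
        Summable.of_norm_bounded (hv _ le_top) fun m => hvb _ m a.1 le_top
      have h3 := h2.hasSum.tendsto_sum_nat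
      exact ((ContinuousMultilinearMap.apply ℝ _ ℝ w).continuous.tendsto _).comp h3
    have hlim2 : Tendsto (fun M => partialDeriv α (F' M) a) atTop (𝓝 (F α a)) := by
      rw [tendsto_iff_dist_tendsto_zero]
      have hz : Tendsto (fun M => 7 ^ n * (3 * C * (2 * Real.exp 1) ^ n) * H M *
          (S + T) ^ deg α * N (deg α)) atTop (𝓝 0) := by
        have := (((hHsum.tendsto_atTop_zero.const_mul
          (7 ^ n * (3 * C * (2 * Real.exp 1) ^ n))).mul_const ((S + T) ^ deg α))).mul_const
          (N (deg α))
        simpa using this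
      refine squeeze_zero' (Eventually.of_forall fun _ => dist_nonneg) ?_ hz
      -- Once `t M < r (deg α)`, the Taylor polynomial at `a` is long enough to have `F α a` as its
      -- derivative there.
      filter_upwards [htlim.eventually (gt_mem_nhds (hr.pos (deg α)))] with M hM
      have hqM : deg α < q M := hr.lt_cutIndex (ht0 M) hM
      have h1 := partialDeriv_sub α (hF'c M) (contDiff_jetPoly F (q M) a) a.1
      have h2 : partialDeriv α (jetPoly F (q M) a) a.1 = F α a :=
        partialDeriv_taylorPoly_self α _ hqM a.1
      rw [Real.dist_eq, ← h2, ← h1]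
      exact (abs_partialDeriv_le α ((hF'c M).sub (contDiff_jetPoly _ _ _)) _).trans
        (hremd M (deg α))
    exact tendsto_nhds_unique hlim1 hlim2
  · rw [iteratedFDeriv_tsum_apply htermc hv hvb le_top x]
    refine (norm_tsum_le_tsum_norm ((hv k le_top).of_nonneg_of_le (fun _ => norm_nonneg _)
      fun m => hvb k m x le_top)).trans ?_
    refine (((hv k le_top).of_nonneg_of_le (fun _ => norm_nonneg _)
      fun m => hvb k m x le_top).tsum_le_tsum (fun m => hvb k m x le_top) (hv k le_top)).trans ?_
    rw [tsum_mul_right, tsum_mul_right, tsum_mul_left]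

/-! ### Weight functions -/

/-- Since `log t = o(ω t)`, `ω (exp y)` outgrows `|x| * y`, so the supremum defining `youngConj` is
finite. -/
lemma IsWeightFunction.bddAbove {ω : ℝ → ℝ} (h : IsWeightFunction ω) (x : ℝ) :
    BddAbove ((fun y : ℝ => x * y - ω (Real.exp y)) '' Set.Ici 0) := by
  have h0 : ∀ y, 0 ≤ y → 0 ≤ ω (Real.exp y) := fun y hy => by
    rw [← h.eq_zero 1 (by simp)]
    exact h.monotoneOn (by simp) (Real.exp_pos y).le (Real.one_le_exp hy)
  have h1 := (h.log_isLittleO.bound (c := (|x| + 1)⁻¹) (by positivity))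
  obtain ⟨t₀, ht₀⟩ := eventually_atTop.1 h1
  set y₀ := |t₀|
  refine ⟨|x| * y₀, ?_⟩
  rintro _ ⟨y, hy, rfl⟩
  have hy' : 0 ≤ y := hy
  have h2 := h0 y hy
  have h3 : x * y ≤ |x| * y := mul_le_mul_of_nonneg_right (le_abs_self x) hy
  rcases le_total y y₀ with hyy | hyy
  · have : |x| * y ≤ |x| * y₀ := mul_le_mul_of_nonneg_left hyy (abs_nonneg x)
    change x * y - ω (Real.exp y) ≤ _
    linarith
  · have h4 := ht₀ (Real.exp y) ((le_abs_self _).trans (hyy.trans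
      (by linarith [Real.add_one_le_exp y])))
    rw [Real.log_exp, Real.norm_eq_abs, Real.norm_eq_abs, abs_of_nonneg hy', abs_of_nonneg h2,
      le_inv_mul_iff₀ (by positivity)] at h4
    have : 0 ≤ |x| * y₀ := by positivity
    change x * y - ω (Real.exp y) ≤ _
    linarith

lemma IsWeightFunction.nonneg {ω : ℝ → ℝ} (h : IsWeightFunction ω) {t : ℝ} (ht : 0 ≤ t) :
    0 ≤ ω t := by
  rw [← h.eq_zero 0 (by simp)]
  exact h.monotoneOn (by simp) ht ht

lemma IsWeightFunction.le_youngConj {ω : ℝ → ℝ} (h : IsWeightFunction ω) (x : ℝ) {y : ℝ}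
    (hy : 0 ≤ y) : x * y - ω (Real.exp y) ≤ youngConj ω x :=
  le_csSup (h.bddAbove x) ⟨y, hy, rfl⟩

lemma youngConj_le {ω : ℝ → ℝ} {x B : ℝ} (h : ∀ y, 0 ≤ y → x * y - ω (Real.exp y) ≤ B) :
    youngConj ω x ≤ B := by
  refine csSup_le ⟨_, 0, Set.mem_Ici.2 le_rfl, rfl⟩ ?_
  rintro _ ⟨y, hy, rfl⟩
  exact h y hy

/-- Iterating `ω (2 t) = O(ω t)`: for every `m`, `ω (2 ^ m t) ≤ B (ω t + 1)`. -/
lemma IsWeightFunction.exists_two_pow_mul_le {ω : ℝ → ℝ} (h : IsWeightFunction ω) (m : ℕ) :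
    ∃ B : ℝ, 1 ≤ B ∧ ∀ t, 0 ≤ t → ω (2 ^ m * t) ≤ B * (ω t + 1) := by
  induction m with
  | zero => exact ⟨1, le_rfl, fun t ht => by simp⟩
  | succ m ih =>
    obtain ⟨B, hB, hm⟩ := ih
    obtain ⟨c, hc⟩ := h.two_mul.bound
    obtain ⟨t₀, ht₀⟩ := eventually_atTop.1 hc
    set M := ω (2 * |t₀|)
    have hM : 0 ≤ M := h.nonneg (by positivity)
    have key : ∀ t, 0 ≤ t → ω (2 * t) ≤ (|c| + M) * (ω t + 1) := fun t ht => by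
      have h0 := h.nonneg ht
      have e : 0 ≤ M * ω t := mul_nonneg hM h0
      have e' : 0 ≤ |c| * ω t := mul_nonneg (abs_nonneg c) h0
      rcases le_total t |t₀| with h1 | h1
      · have : ω (2 * t) ≤ M := h.monotoneOn (Set.mem_Ici.2 (by positivity))
          (Set.mem_Ici.2 (by positivity)) (by linarith)
        nlinarith [abs_nonneg c]
      · have h2 := ht₀ t ((le_abs_self _).trans h1)
        rw [Real.norm_eq_abs, Real.norm_eq_abs, abs_of_nonneg h0,
          abs_of_nonneg (h.nonneg (by positivity))] at h2
        have : c * ω t ≤ |c| * ω t := mul_le_mul_of_nonneg_right (le_abs_self c) h0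
        nlinarith [abs_nonneg c]
    have hBp : 0 ≤ B * (|c| + M) := by positivity
    refine ⟨B * (|c| + M + 1), by nlinarith, fun t ht => ?_⟩
    rw [pow_succ, mul_assoc]
    have h0 := h.nonneg ht
    calc ω (2 ^ m * (2 * t)) ≤ B * (ω (2 * t) + 1) := hm _ (by positivity)
      _ ≤ B * ((|c| + M) * (ω t + 1) + 1) := by
        have := key t ht
        gcongr
      _ ≤ _ := by nlinarith [mul_nonneg (by linarith : (0 : ℝ) ≤ B) h0]

/-- Geometric factors are absorbed by a change of the parameter. -/
lemma IsWeightFunction.exists_pow_mul_assocSeq_le {ω : ℝ → ℝ} (h : IsWeightFunction ω) {x R : ℝ}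
    (hx : 0 < x) (hR : 0 < R) : ∃ ρ : ℕ, 0 < ρ ∧ ∃ B : ℝ, 0 < B ∧ ∀ k : ℕ,
      R ^ k * assocSeq ω x k ≤ B * Real.exp (1 / (ρ : ℝ) * youngConj ω (ρ * k)) := by
  obtain ⟨m, hm⟩ := pow_unbounded_of_one_lt R (one_lt_two (α := ℝ))
  obtain ⟨B, hB, hle⟩ := h.exists_two_pow_mul_le m
  have hB0 : 0 < B := by linarith
  set ρ := ⌈B * x⌉₊ with hρ
  have hρ0 : 0 < ρ := Nat.ceil_pos.2 (by positivity)
  have hρR : (0 : ℝ) < ρ := by exact_mod_cast hρ0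
  have hρx : B * x ≤ ρ := Nat.le_ceil _
  set l := Real.log (2 ^ m) with hl
  have hl0 : 0 ≤ l := Real.log_nonneg (one_le_pow₀ one_le_two)
  refine ⟨ρ, hρ0, Real.exp (1 / x), Real.exp_pos _, fun k => ?_⟩
  have h1 : R ^ k ≤ Real.exp (k * l) := by
    rw [Real.exp_nat_mul, hl, Real.exp_log (by positivity)]
    exact pow_le_pow_left₀ hR.le hm.le k
  have h2 : 1 / x * youngConj ω (x * k) + k * l ≤ 1 / x + 1 / ρ * youngConj ω (ρ * k) := by
    have h3 : youngConj ω (x * k) ≤ x * (1 / x + 1 / ρ * youngConj ω (ρ * k) - k * l) := by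
      refine youngConj_le fun y hy => ?_
      -- Testing the conjugate at `y + l` produces the extra `k * l`, that is, the factor `2 ^ (m *
      -- k)`. The price `ω (2 ^ m * exp y) ≤ B * (ω (exp y) + 1)` is covered by `ρ ≥ B * x`.
      have h4 := h.le_youngConj (ρ * k) (y := y + l) (by positivity)
      have h5 := hle (Real.exp y) (Real.exp_pos y).le
      have h6 : (2 : ℝ) ^ m * Real.exp y = Real.exp (y + l) := by
        rw [Real.exp_add, hl, Real.exp_log (by positivity), mul_comm]
      rw [h6] at h5
      have h7 : 0 ≤ ω (Real.exp (y + l)) := h.nonneg (Real.exp_pos _).le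
      have h8 : x / ρ * ω (Real.exp (y + l)) ≤ ω (Real.exp y) + 1 := by
        have : x / ρ ≤ 1 / B := by
          rw [div_le_div_iff₀ hρR hB0]; linarith
        calc _ ≤ 1 / B * (B * (ω (Real.exp y) + 1)) := by gcongr
          _ = _ := by field_simp
      have h9 : x / ρ * (ρ * k * (y + l) - ω (Real.exp (y + l))) ≤
          x / ρ * youngConj ω (ρ * k) := by gcongr
      have e1 : x / ρ * (ρ * k * (y + l) - ω (Real.exp (y + l))) =
          x * k * (y + l) - x / ρ * ω (Real.exp (y + l)) := by field_simp
      have e2 : x * (1 / x + 1 / ρ * youngConj ω (ρ * k) - k * l) =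
          1 + x / ρ * youngConj ω (ρ * k) - x * k * l := by field_simp
      rw [e2]
      rw [e1] at h9
      linarith
    have : 1 / x * youngConj ω (x * k) ≤ 1 / x + 1 / ρ * youngConj ω (ρ * k) - k * l := by
      rw [one_div, inv_mul_le_iff₀ hx, ← one_div]
      exact h3
    linarith
  calc R ^ k * assocSeq ω x k ≤ Real.exp (k * l) * Real.exp (1 / x * youngConj ω (x * k)) :=
        mul_le_mul_of_nonneg_right h1 (Real.exp_pos _).le
    _ = Real.exp (1 / x * youngConj ω (x * k) + k * l) := by rw [← Real.exp_add, add_comm]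
    _ ≤ Real.exp (1 / x + 1 / ρ * youngConj ω (ρ * k)) := Real.exp_le_exp.2 h2
    _ = _ := Real.exp_add _ _

/-! ### Comparison with the descendant -/

/-- The second relation, inverted, bounds `k T_{k-1} / T_k` by a multiple of `k W_{k-1} / W_k`, and
the first bounds the tail likewise. Adding them gives `r_{k-1} ≲ k W_{k-1} / W_k` for `r = descRatio
(quot T)`, and multiplying the resulting bounds on `W_k / W_{k-1}` gives the claim. -/
lemma IsNonquasi.exists_le_invProd {T W : ℕ → ℝ} (hT : IsNonquasi (quot T))
    (hW : ∀ k, 0 < W k)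
    (h1 : Lesssim (fun k => ∑' j : ℕ, T (k + j - 1) / T (k + j))
      (fun k => (k : ℝ) * W (k - 1) / W k))
    (h2 : Lesssim (fun k => W k / W (k - 1)) (fun k => T k / T (k - 1))) :
    ∃ B : ℝ, 0 < B ∧ ∀ k, W k ≤ W 0 * (B ^ k * (k.factorial * invProd (descRatio (quot T)) k)) := by
  obtain ⟨C₁, hC₁, h1⟩ := h1
  obtain ⟨C₂, hC₂, h2⟩ := h2
  refine ⟨C₂ + C₁, by positivity, fun k => ?_⟩
  induction k with
  | zero => simp [invProd_zero]
  | succ k ih =>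
    have g1 := h1 (k + 1) (by omega)
    have g2 := h2 (k + 1) (by omega)
    simp only [Nat.add_sub_cancel] at g1 g2
    have e : ∑' j : ℕ, T (k + 1 + j - 1) / T (k + 1 + j) = ∑' j, 1 / quot T (k + 1 + j) :=
      tsum_congr fun j => by
        rw [show k + 1 + j = k + j + 1 by ring, Nat.add_sub_cancel, quot, one_div_div]
    rw [e] at g1
    have hq : quot T (k + 1) = T (k + 1) / T k := rfl
    rw [← hq] at g2
    have hd := hT.isNull.pos k
    have hk := hW k
    have hk1 := hW (k + 1)
    have hqp := hT.pos (k + 1)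
    have key : W (k + 1) ≤ W k * ((C₂ + C₁) * ((k + 1) * (descRatio (quot T) k)⁻¹)) := by
      have g3 : ((k : ℝ) + 1) / quot T (k + 1) ≤ C₂ * (((k : ℝ) + 1) * W k / W (k + 1)) := by
        rw [div_le_iff₀ hqp]
        rw [div_le_iff₀ hk] at g2
        rw [mul_assoc, div_mul_eq_mul_div, mul_div_assoc', le_div_iff₀ hk1]
        nlinarith [(Nat.cast_nonneg k : (0 : ℝ) ≤ k)]
      have g4 : descRatio (quot T) k ≤ (C₂ + C₁) * (((k : ℝ) + 1) * W k / W (k + 1)) := by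
        rw [descRatio]
        push_cast at g1
        linarith
      rw [mul_div_assoc', le_div_iff₀ hk1] at g4
      calc W (k + 1) = descRatio (quot T) k * W (k + 1) * (descRatio (quot T) k)⁻¹ := by
            field_simp
        _ ≤ (C₂ + C₁) * ((k + 1) * W k) * (descRatio (quot T) k)⁻¹ := by gcongr
        _ = _ := by ring
    calc W (k + 1) ≤ W k * ((C₂ + C₁) * ((k + 1) * (descRatio (quot T) k)⁻¹)) := key
      _ ≤ W 0 * ((C₂ + C₁) ^ k * (k.factorial * invProd (descRatio (quot T)) k)) *
          ((C₂ + C₁) * ((k + 1) * (descRatio (quot T) k)⁻¹)) := by gcongr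
      _ = _ := by
        rw [invProd_succ, Nat.factorial_succ]
        push_cast
        ring

lemma exists_jetBound {E : Set (EuclideanSpace ℝ (Fin n))} {F : JetFamily E} {W r : ℕ → ℝ}
    (hF : F ∈ jetClassSeq W E) {A B : ℝ} (hA : 0 ≤ A) (hB : 0 < B)
    (hW0 : ∀ k, 0 < W k) (hW : ∀ k, W k ≤ A * (B ^ k * (k.factorial * invProd r k))) :
    ∃ C ρ : ℝ, 0 ≤ C ∧ 0 < ρ ∧ JetBound F r C ρ := by
  obtain ⟨-, ρ, hρ, C, h1, h2⟩ := hF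
  have hρ0 : (0 : ℝ) < ρ := by exact_mod_cast hρ
  have key : ∀ k : ℕ, C * (ρ : ℝ) ^ k * W k ≤
      |C| * A * (ρ * B) ^ k * (k.factorial * invProd r k) := fun k => by
    have hWk := hW0 k
    calc C * (ρ : ℝ) ^ k * W k ≤ |C| * (ρ : ℝ) ^ k * W k := by
          gcongr; exact le_abs_self C
      _ ≤ |C| * (ρ : ℝ) ^ k * (A * (B ^ k * (k.factorial * invProd r k))) := by
          gcongr; exact hW k
      _ = _ := by rw [mul_pow]; ring
  refine ⟨|C| * A, ρ * B, by positivity, by positivity, fun α a => (h1 α a).trans (key _),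
    fun p α hp a b => (h2 p α hp a b).trans ?_⟩
  exact mul_le_mul_of_nonneg_right (key _) (by positivity)

end Ultradiff

/-! ### The extension theorem for weight functions. -/

theorem corollary5p8 (τ ω : ℝ → ℝ)
    (hτ : Ultradiff.IsAdmissible τ) (hω : Ultradiff.IsWeightFunction ω)
    (hωτ : ∀ W ∈ Ultradiff.assocMatrix ω, ∃ T ∈ Ultradiff.assocMatrix τ,
      Ultradiff.Lesssim (fun k => ∑' j : ℕ, T (k + j - 1) / T (k + j))
        (fun k => (k : ℝ) * W (k - 1) / W k) ∧
      Ultradiff.Lesssim (fun k => W k / W (k - 1)) (fun k => T k / T (k - 1)))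
    (n : ℕ) (E : Set (EuclideanSpace ℝ (Fin n))) (hE : IsCompact E) :
    Set.SurjOn (Ultradiff.jetMap E) (Ultradiff.globalClass τ n) (Ultradiff.jetClass ω E) := by
  open Ultradiff in
  rintro F ⟨W, hWω, hF⟩
  have hadm := hτ.isAdmissibleMatrix
  obtain ⟨T, hT, hT1, hT2⟩ := hωτ W hWω
  have hWpos : ∀ k, 0 < W k := by
    obtain ⟨x, -, rfl⟩ := hWω
    exact fun k => Real.exp_pos _
  have hTn := hadm.isNonquasi hT
  obtain ⟨B, hB, hWB⟩ := hTn.exists_le_invProd hWpos hT1 hT2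
  obtain ⟨C, ρ, hC, hρ, hJ⟩ := exists_jetBound hF (hWpos 0).le hB hWpos hWB
  obtain ⟨N, hN, D, hD, hND⟩ := hadm.exists_minWeight_le hT (2 * n + 2)
  have hNn := hadm.isNonquasi hN
  have hNw := hadm.isWeightMatrix.isWeightSequence N hN
  -- The exponent obtained is `2 ^ (2 * n + 2)`, more than needed; it may be lowered because minimal
  -- weights are at most one.
  have hpow : ∀ t, 0 < t → minWeight (descRatio (quot T)) t ≤
      minWeight (descRatio (quot N)) (D * t) ^ (2 * n + 2) := fun t ht =>
    (hND t ht).trans (pow_le_pow_of_le_one (hNn.isNull.minWeight_pos (mul_pos hD ht)).le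
      (hNn.isNull.minWeight_le_one (mul_pos hD ht)) Nat.lt_two_pow_self.le)
  have hext : ∃ f : EuclideanSpace ℝ (Fin n) → ℝ, ContDiff ℝ (⊤ : ℕ∞) f ∧
      (∀ α (a : E), partialDeriv α f a = F α a) ∧
      ∃ A R : ℝ, 0 < R ∧ ∀ k x, ‖iteratedFDeriv ℝ k f x‖ ≤ A * R ^ k * N k := by
    -- The construction needs base points in `E`; for empty `E` the zero function serves.
    rcases E.eq_empty_or_nonempty with rfl | hne
    · exact ⟨0, contDiff_zero_fun, fun α a => a.2.elim, 0, 1, one_pos, fun k x => by simp⟩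
    · exact hJ.exists_extension hE hne hTn.isNull hC hρ hNn hNw.zero hNw.pos hNw.mul_le
        (prod_quot hNw.zero hNw.pos) hD hpow
  obtain ⟨f, hf, hjet, A, R, hR, hbound⟩ := hext
  refine ⟨f, ⟨hf, ?_⟩, funext fun α => funext fun a => hjet α a⟩
  obtain ⟨y, hy, rfl⟩ := hN
  -- The factor `R ^ k` is absorbed by passing to an integer parameter `p`, as `globalClass`
  -- requires.
  obtain ⟨p, hp, B', hB', hle⟩ := hτ.isWeightFunction.exists_pow_mul_assocSeq_le hy hR
  refine ⟨p, hp, |A| * B', fun α x => ?_⟩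
  rw [Real.exp_neg, ← div_eq_mul_inv, div_le_iff₀ (Real.exp_pos _)]
  calc |partialDeriv α f x| ≤ _ := abs_partialDeriv_le α hf x
    _ ≤ _ := hbound _ x
    _ ≤ |A| * (R ^ deg α * assocSeq τ y (deg α)) := by
      rw [mul_assoc]
      exact mul_le_mul_of_nonneg_right (le_abs_self A)
        (mul_nonneg (by positivity) (Real.exp_pos _).le)
    _ ≤ |A| * (B' * _) := mul_le_mul_of_nonneg_left (hle _) (abs_nonneg A)
    _ = _ := by ring
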